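/- **Setting.** Let $N,H,T\ge 1$. Consider an $N$-player episodic general-sum Markov game with horizon $H$, finite state space $\mathcal S$, finite nonempty action sets $\mathcal A_i$ ($i\in[N]$), joint actions $\mathcal A=\prod_i\mathcal A_i$, rewards $r_{i,h}:\mathcal S\times\mathcal A\to[0,1]$, transition laws $P_h(\cdot\mid s,a)$, and a fixed initial state $s_1$. Put $|\mathcal A_{\max}|=\max_i|\mathcal A_i|$ and $[P_hV](s,a)=\sum_{s'}P_h(s'\mid s,a)V(s')$. For a profile $\pi_h(\cdot\mid s)=\prod_i\pi_{i,h}(\cdot\mid s)$ of mixed actions, $[Q\pi_h](s)$ is the mean of $Q(s,a)$ under $a\sim\pi_h(\cdot\mid s)$, and $[Q\pi_{-i,h}](s,a_i)$ the mean of $Q(s,a_i,a_{-i})$ under $a_{-i}\sim\prod_{j\ne i}\pi_{j,h}(\cdot\mid s)$. **Weights.** $\alpha_t=\frac{H+1}{H+t}$; $\alpha_t^j=\alpha_j\prod_{k=j+1}^t(1-\alpha_k)$ for $1\le j\le t$; $w_t=\alpha_t^t/\alpha_t^1$; $\eta_t=\eta/w_t$. **Algorithms.** In both algorithms, for all $i,h,s$,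 $u^{(0)}_{i,h}(s,\cdot)=0$, $U^{(t)}_{i,h}=\sum_{\tau=1}^{t-1}u^{(\tau)}_{i,h}$, and the optimistic signal in round $t\in[T]$ is $\mathcal R^{(t)}_{i,h}(s,\cdot)=\eta_t\big(U^{(t)}_{i,h}+\frac{w_t}{w_{t-1}}u^{(t-1)}_{i,h}\big)(s,\cdot)$ (the last term is $0$ for $t=1$). *MG-DLRC-OFTRL.* In round $t$, with $d=|\mathcal A_i|$, $(0,1]\Delta^d=\{y\in\mathbb R^d_{\ge0}:0<\sum_ky[k]\le1\}$ and $\Psi(y)=-\tilde\alpha\log\big(\sum_ky[k]\big)+\frac1{\sum_ky[k]}\sum_ky[k]\log y[k]$ (with $0\log0=0$), $$y^{(t)}_{i,h}(s,\cdot)\in\arg\max_{y\in(0,1]\Delta^d}\big[\langle\mathcal R^{(t)}_{i,h}(s,\cdot),y\rangle-\Psi(y)\big],\qquad \pi^{(t)}_{i,h}(a_i\mid s)=\frac{y^{(t)}_{i,h}(s,a_i)}{\sum_{a_i'}y^{(t)}_{i,h}(s,a_i')}.$$ Then, for $h=H,\dots,1$, with $Q^{(0)}=0$ and $[Q^{(t)}_{i,H+1}\pi^{(t)}_{H+1}]=0$,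 $$Q^{(t)}_{i,h}=(1-\alpha_t)Q^{(t-1)}_{i,h}+\alpha_t\big(r_{i,h}+P_h[Q^{(t)}_{i,h+1}\pi^{(t)}_{h+1}]\big),\qquad u^{(t)}_{i,h}(s,\cdot)=w_t\big([Q^{(t)}_{i,h}\pi^{(t)}_{-i,h}](s,\cdot)-[Q^{(t)}_{i,h}\pi^{(t)}_h](s)\mathbf 1\big).$$ *MG-DLRC-OMWU with V-updates.* In round $t$, $$\lambda\in\arg\max_{\lambda\in(0,1]}\Big[(\tilde\alpha-1)\log\lambda+\log\sum_{a_i'}e^{\lambda\mathcal R^{(t)}_{i,h}(s,a_i')}\Big],\qquad \pi^{(t)}_{i,h}(a_i\mid s)=\frac{e^{\lambda\mathcal R^{(t)}_{i,h}(s,a_i)}}{\sum_{a_i'}e^{\lambda\mathcal R^{(t)}_{i,h}(s,a_i')}},$$ with a separate $\lambda$ for each $(i,h,s)$. Then, for $h=H,\dots,1$, with $V^{(0)}=0$ and $V^{(t)}_{i,H+1}=0$, $$V^{(t)}_{i,h}=(1-\alpha_t)V^{(t-1)}_{i,h}+\alpha_t\big[(r_{i,h}+P_hV^{(t)}_{i,h+1})\pi^{(t)}_h\big],\qquad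 u^{(t)}_{i,h}(s,\cdot)=w_t\big(\nu^{(t)}_{i,h}(s,\cdot)-\langle\nu^{(t)}_{i,h}(s,\cdot),\pi^{(t)}_{i,h}(\cdot\mid s)\rangle\mathbf 1\big),$$ where $\nu^{(t)}_{i,h}=[(r_{i,h}+P_hV^{(t)}_{i,h+1})\pi^{(t)}_{-i,h}]$. **Output policy.** $\bar\pi$ is the correlated policy that draws $j_1\in[T]$ with probability $\alpha_T^{j_1}$ and, for $h=1,\dots,H-1$, draws $j_{h+1}\in[j_h]$ with probability $\alpha_{j_h}^{j_{h+1}}$ (these indices are common to all players), and plays $\pi^{(j_h)}_h(\cdot\mid s_h)$ at each step $h$. **CCE gap.** $\text{CCE-Gap}(\bar\pi)=\max_{i\in[N]}\big[\sup_{\pi_i'}V_{i,1}^{(\pi_i',\bar\pi_{-i})}(s_1)-V_{i,1}^{\bar\pi}(s_1)\big]$, where $V_{i,1}^{\pi}(s_1)$ is the expected total reward of player $i$ over the episode, and the supremum is over all randomized policies of player $i$ that may depend on the history of states and joint actions and on the current state, but not on the indices $j_h$. **Theorem 1.** Let $\beta\ge70$, $\tilde\alpha=\beta\log^2|\mathcal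 A_{\max}|+2\log|\mathcal A_{\max}|+2$ and $\eta=\frac1{24H^{3/2}N}$. Suppose that every player runs MG-DLRC-OFTRL for $T$ rounds with these parameters. Such a run exists, and a sequence of policies is a run of MG-DLRC-OFTRL if and only if it is a run of MG-DLRC-OMWU with V-updates. The output policy of every such run satisfies $$\text{CCE-Gap}(\bar\pi)\le\frac{864\,H^{7/2}N\big(\tilde\alpha\log T+2\log|\mathcal A_{\max}|+2\big)}{T}.$$ -/

import Mathlib

open scoped BigOperators

/-! ### Step sizes and averaging weights -/

/-- The step size `α_t = (H + 1) / (H + t)`. -/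
noncomputable def stepSize (H t : ℕ) : ℝ := ((H : ℝ) + 1) / ((H : ℝ) + (t : ℝ))

/-- The averaging weight `α_t^j = α_j ∏_{k = j + 1}^t (1 - α_k)` for `1 ≤ j ≤ t`
(in particular `α_t^t = α_t`); it is `0` for every other index `j`. -/
noncomputable def avgWeight (H t j : ℕ) : ℝ :=
  if 1 ≤ j ∧ j ≤ t then stepSize H j * ∏ k ∈ Finset.Ioc j t, (1 - stepSize H k) else 0

/-- The utility weight `w_t = α_t^t / α_t^1`. -/
noncomputable def utilWeight (H t : ℕ) : ℝ := avgWeight H t t / avgWeight H t 1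

theorem stepSize_nonneg (H t : ℕ) : 0 ≤ stepSize H t := by
  unfold stepSize; positivity

theorem stepSize_le_one (H t : ℕ) (ht : 1 ≤ t) : stepSize H t ≤ 1 := by
  unfold stepSize
  have h1 : (1 : ℝ) ≤ t := by exact_mod_cast ht
  have h2 : (0 : ℝ) ≤ H := Nat.cast_nonneg H
  rw [div_le_one (by linarith)]
  linarith

theorem avgWeight_nonneg (H t j : ℕ) : 0 ≤ avgWeight H t j := by
  unfold avgWeight
  split_ifs with h
  · refine mul_nonneg (stepSize_nonneg H j) (Finset.prod_nonneg fun k hk => ?_)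
    have := stepSize_le_one H k (by have := (Finset.mem_Ioc.mp hk).1; omega)
    linarith
  · exact le_rfl

theorem avgWeight_succ (H t j : ℕ) (hj : j ≤ t) :
    avgWeight H (t + 1) j = (1 - stepSize H (t + 1)) * avgWeight H t j := by
  unfold avgWeight
  by_cases h1 : 1 ≤ j
  · rw [if_pos ⟨h1, by omega⟩, if_pos ⟨h1, hj⟩, Finset.prod_Ioc_succ_top (by omega)]
    ring
  · rw [if_neg (by omega), if_neg (by omega), mul_zero]

theorem avgWeight_self (H t : ℕ) (ht : 1 ≤ t) : avgWeight H t t = stepSize H t := by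
  simp [avgWeight, ht]

theorem sum_range_avgWeight (H t : ℕ) (ht : 1 ≤ t) :
    ∑ j ∈ Finset.range t, avgWeight H t (j + 1) = 1 := by
  induction t, ht using Nat.le_induction with
  | base =>
    have h : (H : ℝ) + 1 ≠ 0 := by positivity
    simp [avgWeight_self, stepSize, h]
  | succ t ht ih =>
    rw [Finset.sum_range_succ, avgWeight_self H (t + 1) (by omega),
      Finset.sum_congr rfl (fun j hj => avgWeight_succ H t (j + 1)
        (by have := Finset.mem_range.mp hj; omega)), ← Finset.mul_sum, ih]
    ring

theorem sum_fin_avgWeight (H T t : ℕ) (ht : 1 ≤ t) (htT : t ≤ T) :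
    ∑ j : Fin T, avgWeight H t ((j : ℕ) + 1) = 1 := by
  rw [Fin.sum_univ_eq_sum_range (fun j => avgWeight H t (j + 1)) T,
    ← sum_range_avgWeight H t ht]
  symm
  refine Finset.sum_subset (fun j hj => ?_) (fun j _ hj => ?_)
  · rw [Finset.mem_range] at hj ⊢; omega
  · rw [Finset.mem_range] at hj
    unfold avgWeight
    rw [if_neg (by omega)]

/-! ### Markov games, correlated policies, and the CCE gap -/

/-- An `N`-player episodic general-sum Markov game with horizon `H`, finite state space `S`,
finite action sets `A i`, rewards in `[0, 1]`, and a fixed initial state.  The steps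
`1, …, H` are represented by `Fin H`. -/
structure MarkovGame (N H : ℕ) (S : Type*) (A : Fin N → Type*) [Fintype S] where
  /-- the reward `r_{i,h}(s, a)` -/
  reward : Fin N → Fin H → S → (∀ i, A i) → ℝ
  /-- rewards lie in `[0, 1]` -/
  reward_mem : ∀ i h s a, reward i h s a ∈ Set.Icc (0 : ℝ) 1
  /-- the transition law `P_h(· | s, a)` -/
  trans : Fin H → S → (∀ i, A i) → stdSimplex ℝ S
  /-- the initial state -/
  init : S

/-- The product law of a profile of mixed actions. -/
noncomputable def prodLaw {N : ℕ} {A : Fin N → Type*} [∀ i, Fintype (A i)]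
    (x : ∀ i, stdSimplex ℝ (A i)) : stdSimplex ℝ (∀ i, A i) :=
  ⟨fun a => ∏ i, x i (a i), fun a => Finset.prod_nonneg fun i _ => (x i).2.1 (a i), by
    have h := Fintype.prod_sum (fun i (b : A i) => x i b)
    rw [← h]
    exact Finset.prod_eq_one fun i _ => (x i).2.2⟩

/-- The mean `⟨Q, x⟩` of a function of the joint action when all players act
independently according to the profile `x`. -/
noncomputable def meanJoint {N : ℕ} {A : Fin N → Type*} [∀ i, Fintype (A i)]
    (q : (∀ i, A i) → ℝ) (x : ∀ i, stdSimplex ℝ (A i)) : ℝ :=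
  ∑ a, prodLaw x a * q a

/-- The mean `⟨Q(b, ·), x_{-i}⟩` of a function of the joint action when player `i` plays `b` and
all other players act independently according to the profile `x`. -/
noncomputable def meanOthers {N : ℕ} {A : Fin N → Type*} [∀ i, Fintype (A i)]
    [∀ i, DecidableEq (A i)] (q : (∀ i, A i) → ℝ) (x : ∀ i, stdSimplex ℝ (A i))
    (i : Fin N) (b : A i) : ℝ :=
  ∑ a : ∀ j, A j, if a i = b then (∏ j ∈ Finset.univ.erase i, x j (a j)) * q a else 0

/-- The number of actions of the player with most actions. -/
def maxActions {N : ℕ} (A : Fin N → Type*) [∀ i, Fintype (A i)] : ℕ :=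
  Finset.univ.sup fun i => Fintype.card (A i)

/-- A history: the list of the state-action pairs visited so far, the oldest first. -/
abbrev History {N : ℕ} (S : Type*) (A : Fin N → Type*) := List (S × (∀ i, A i))

/-- A correlated policy with (finite) seed space `Ω`: a seed is drawn once at the start of the
episode, and at each step the joint action is drawn from a law that depends on the seed, the
history of states and joint actions, and the current state. -/
structure CorrelatedPolicy (H : ℕ) {N : ℕ} (S : Type*) (A : Fin N → Type*)
    [∀ i, Fintype (A i)] (Ω : Type*) [Fintype Ω] where
  /-- the law of the seed -/
  seedLaw : stdSimplex ℝ Ω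
  /-- the decision rules -/
  rule : Ω → Fin H → History S A → S → stdSimplex ℝ (∀ i, A i)

/-- A (non-Markov, randomized) policy of player `i`, who observes the history of states and joint
actions and the current state, but not the seed of the other players. -/
abbrev Deviation (H : ℕ) {N : ℕ} (S : Type*) (A : Fin N → Type*) [∀ i, Fintype (A i)]
    (i : Fin N) := Fin H → History S A → S → stdSimplex ℝ (A i)

/-- The law on joint actions under which player `i` draws an action from `σ` and, independently,
the other players draw theirs from the marginal of `p`. -/
noncomputable def replaceLaw {N : ℕ} {A : Fin N → Type*} [∀ i, Fintype (A i)] (i : Fin N)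
    (σ : stdSimplex ℝ (A i)) (p : stdSimplex ℝ (∀ j, A j)) : stdSimplex ℝ (∀ j, A j) :=
  ⟨fun a => σ (a i) * ∑ b : A i, p (Function.update a i b),
    fun a => mul_nonneg (σ.2.1 _) (Finset.sum_nonneg fun b _ => p.2.1 _), by
    have e : ∑ z : (∀ j, A j) × A i, σ (z.1 i) * p (Function.update z.1 i z.2)
        = ∑ z : (∀ j, A j) × A i, σ z.2 * p z.1 := by
      refine Finset.sum_nbij' (fun z => (Function.update z.1 i z.2, z.1 i))
        (fun z => (Function.update z.1 i z.2, z.1 i)) ?_ ?_ ?_ ?_ ?_ <;> simp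
    rw [Fintype.sum_prod_type, Fintype.sum_prod_type] at e
    simp only [← Finset.mul_sum, ← Finset.sum_mul] at e
    have h1 : ∑ b, σ b = 1 := σ.2.2
    have h2 : ∑ a, p a = 1 := p.2.2
    rw [h1] at e
    simpa [h2] using e⟩

/-- The policy `(π'_i, π_{-i})`. -/
noncomputable def CorrelatedPolicy.deviate {N H : ℕ} {S : Type*} {A : Fin N → Type*}
    [∀ i, Fintype (A i)] {Ω : Type*} [Fintype Ω] (π : CorrelatedPolicy H S A Ω) (i : Fin N)
    (σ : Deviation H S A i) : CorrelatedPolicy H S A Ω where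
  seedLaw := π.seedLaw
  rule := fun ω h τ s => replaceLaw i (σ h τ s) (π.rule ω h τ s)

namespace MarkovGame

variable {N H : ℕ} {S : Type*} {A : Fin N → Type*} [Fintype S] [∀ i, Fintype (A i)]

/-- The expectation of a functional `F` of the whole trajectory of states and joint actions when
at step `h` the history is `τ` and the state is `s`, joint actions are drawn from the rule `μ`,
and states from the transition laws of the game. -/
noncomputable def expect (G : MarkovGame N H S A)
    (μ : Fin H → History S A → S → stdSimplex ℝ (∀ i, A i)) :
    Fin (H + 1) → History S A → S → (History S A → ℝ) → ℝ :=
  Fin.reverseInduction (motive := fun _ => History S A → S → (History S A → ℝ) → ℝ)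
    (fun τ _ F => F τ)
    (fun h next τ s F =>
      ∑ a, μ h τ s a * ∑ s', G.trans h s a s' * next (τ ++ [(s, a)]) s' F)

/-- The total reward `∑_h r_{i,h}(s_h, a_h)` of player `i` along a trajectory. -/
noncomputable def totalReward (G : MarkovGame N H S A) (i : Fin N) (τ : History S A) : ℝ :=
  ∑ h : Fin H, (τ[(h : ℕ)]?).elim 0 fun z => G.reward i h z.1 z.2

/-- The value `V_{i,1}^π(s_1)` of a correlated policy: the expected total reward of player `i`. -/
noncomputable def value (G : MarkovGame N H S A) {Ω : Type*} [Fintype Ω]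
    (π : CorrelatedPolicy H S A Ω) (i : Fin N) : ℝ :=
  ∑ ω, π.seedLaw ω * G.expect (π.rule ω) 0 [] G.init (G.totalReward i)

/-- The best-response value of player `i` against `π_{-i}`. -/
noncomputable def bestResponseValue (G : MarkovGame N H S A) {Ω : Type*} [Fintype Ω]
    (π : CorrelatedPolicy H S A Ω) (i : Fin N) : ℝ :=
  ⨆ σ : Deviation H S A i, G.value (π.deviate i σ) i

/-- The CCE gap of a correlated policy. -/
noncomputable def cceGap (G : MarkovGame N H S A) {Ω : Type*} [Fintype Ω]
    (π : CorrelatedPolicy H S A Ω) : ℝ :=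
  ⨆ i : Fin N, (G.bestResponseValue π i - G.value π i)

end MarkovGame

/-! ### The roll-out policy -/

/-- A sequence of Markov product policies: `π t i h s` is the mixed action of player `i` in state
`s` at step `h` in round `t`. Rounds are numbered from `1`. -/
abbrev PolicySeq {N : ℕ} (H : ℕ) (S : Type*) (A : Fin N → Type*) [∀ i, Fintype (A i)] :=
  ℕ → ∀ i : Fin N, Fin H → S → stdSimplex ℝ (A i)

/-- The probability that the round indices drawn at `n` consecutive steps are
`j_1, …, j_n` when the first is drawn from the weights `α_t^•` and each further one from the
weights `α_j^•`, where `j` is its predecessor. The round `j` is represented by `j - 1 : Fin T`. -/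
noncomputable def chainProb (H T : ℕ) : (n : ℕ) → (t : ℕ) → (Fin n → Fin T) → ℝ
  | 0, _, _ => 1
  | n + 1, t, ω =>
      avgWeight H t ((ω 0 : ℕ) + 1) * chainProb H T n ((ω 0 : ℕ) + 1) (Fin.tail ω)

theorem chainProb_nonneg (H T n t : ℕ) (ω : Fin n → Fin T) : 0 ≤ chainProb H T n t ω := by
  induction n generalizing t with
  | zero => simp [chainProb]
  | succ n ih => exact mul_nonneg (avgWeight_nonneg _ _ _) (ih _ _)

theorem sum_chainProb (H T n t : ℕ) (ht : 1 ≤ t) (htT : t ≤ T) :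
    ∑ ω, chainProb H T n t ω = 1 := by
  induction n generalizing t with
  | zero => simp [chainProb]
  | succ n ih =>
    rw [← (Fin.consEquiv fun _ : Fin (n + 1) => Fin T).sum_comp, Fintype.sum_prod_type]
    have key : ∀ j : Fin T, ∑ ω : Fin n → Fin T,
        chainProb H T (n + 1) t ((Fin.consEquiv fun _ : Fin (n + 1) => Fin T) (j, ω))
          = avgWeight H t ((j : ℕ) + 1) := by
      intro j
      simp only [chainProb, Fin.consEquiv, Equiv.coe_fn_mk, Fin.cons_zero, Fin.tail_cons]
      rw [← Finset.mul_sum, ih _ (by omega) (by omega), mul_one]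
    rw [Finset.sum_congr rfl fun j _ => key j]
    exact sum_fin_avgWeight H T t ht htT

/-- The output policy: at step `1` a round `j_1 ∈ [T]` is drawn with probability `α_T^{j_1}` and
the product policy of round `j_1` is played; at each further step `h + 1` a round `j_{h+1}` is
drawn with probability `α_{j_h}^{j_{h+1}}` and the product policy of that round is played. The
indices are common to all players; they form the seed. -/
noncomputable def rollout {N H : ℕ} {S : Type*} {A : Fin N → Type*} [∀ i, Fintype (A i)]
    (T : ℕ) (hT : 1 ≤ T) (π : PolicySeq H S A) : CorrelatedPolicy H S A (Fin H → Fin T) where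
  seedLaw := ⟨chainProb H T H T, chainProb_nonneg H T H T, sum_chainProb H T H T hT le_rfl⟩
  rule := fun ω h _ s => prodLaw fun i => π ((ω h : ℕ) + 1) i h s

/-! ### The learning algorithms

For a sequence `π` of policies, the iterates below are those which the algorithms compute when
the policies played in the successive rounds are those of `π`. -/

/-- The optimistic signal `R^(t) = η_t (U^(t) + (w_t / w_{t-1}) u^(t-1))` at one state and step,
where `U^(t) = ∑_{τ=1}^{t-1} u^(τ)` and `η_t = η / w_t`. -/
noncomputable def optimisticSignal (H : ℕ) (η : ℝ) {B : Type*} (u : ℕ → B → ℝ) (t : ℕ)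
    (b : B) : ℝ :=
  η / utilWeight H t *
    (∑ τ ∈ Finset.Ico 1 t, u τ b + utilWeight H t / utilWeight H (t - 1) * u (t - 1) b)

/-- The objective maximized over `λ ∈ (0, 1]` by the dynamic learning rate. -/
noncomputable def rateObjective {B : Type*} [Fintype B] (α : ℝ) (R : B → ℝ) (lam : ℝ) : ℝ :=
  (α - 1) * Real.log lam + Real.log (∑ b, Real.exp (lam * R b))

/-- The set `(0, 1] Δ` of nonnegative vectors with total mass in `(0, 1]`. -/
def liftedSimplex (B : Type*) [Fintype B] : Set (B → ℝ) :=
  {y | (∀ b, 0 ≤ y b) ∧ 0 < ∑ b, y b ∧ ∑ b, y b ≤ 1}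

/-- The regularizer `Ψ(y) = -α log (∑ y) + (∑ y)⁻¹ ∑ y log y` (with `0 log 0 = 0`). -/
noncomputable def regularizer {B : Type*} [Fintype B] (α : ℝ) (y : B → ℝ) : ℝ :=
  -α * Real.log (∑ b, y b) + 1 / (∑ b, y b) * ∑ b, y b * Real.log (y b)

namespace MarkovGame

variable {N H : ℕ} {S : Type*} {A : Fin N → Type*} [Fintype S] [∀ i, Fintype (A i)]

/-- The iterates `V_{i,h}^(t)` of the algorithm with `V`-updates; `V_{i,H+1} = 0`. -/
noncomputable def vIter (G : MarkovGame N H S A) (π : PolicySeq H S A) :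
    ℕ → Fin N → Fin (H + 1) → S → ℝ
  | 0 => fun _ _ _ => 0
  | t + 1 => fun i => Fin.reverseInduction (motive := fun _ => S → ℝ) (fun _ => 0)
      (fun h next s =>
        (1 - stepSize H (t + 1)) * vIter G π t i h.castSucc s
          + stepSize H (t + 1) * meanJoint
            (fun a => G.reward i h s a + ∑ s', G.trans h s a s' * next s')
            (fun j => π (t + 1) j h s))

/-- The iterates `Q_{i,h}^(t)` of the algorithm with `Q`-updates; `Q_{i,H+1} = 0`. -/
noncomputable def qIter (G : MarkovGame N H S A) (π : PolicySeq H S A) :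
    ℕ → Fin N → Fin (H + 1) → S → (∀ j, A j) → ℝ
  | 0 => fun _ _ _ _ => 0
  | t + 1 => fun i => Fin.reverseInduction (motive := fun _ => S → (∀ j, A j) → ℝ)
      (fun _ _ => 0)
      (fun h next s a =>
        (1 - stepSize H (t + 1)) * qIter G π t i h.castSucc s a
          + stepSize H (t + 1) * (G.reward i h s a + ∑ s', G.trans h s a s' *
            if hh : (h : ℕ) + 1 < H then
              meanJoint (next s') (fun j => π (t + 1) j ⟨(h : ℕ) + 1, hh⟩ s')
            else 0))

variable [∀ i, DecidableEq (A i)]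

/-- The expected utility vector `ν_{i,h}^(t)(s, ·) = [(r_{i,h} + P_h V_{i,h+1}^(t)) π_{-i,h}^(t)]`
of the algorithm with `V`-updates. -/
noncomputable def vUtility (G : MarkovGame N H S A) (π : PolicySeq H S A) (i : Fin N)
    (h : Fin H) (s : S) (t : ℕ) (b : A i) : ℝ :=
  meanOthers (fun a => G.reward i h s a + ∑ s', G.trans h s a s' * G.vIter π t i h.succ s')
    (fun j => π t j h s) i b

/-- The regret vectors `u^(t) = w_t (ν^(t) - ⟨ν^(t), π_i^(t)⟩ 1)` of the algorithm with
`V`-updates; `u^(0) = 0`. -/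
noncomputable def vRegretVec (G : MarkovGame N H S A) (π : PolicySeq H S A) (i : Fin N)
    (h : Fin H) (s : S) (t : ℕ) (b : A i) : ℝ :=
  if t = 0 then 0 else
    utilWeight H t * (G.vUtility π i h s t b - ∑ c, π t i h s c * G.vUtility π i h s t c)

/-- The regret vectors `u^(t) = w_t ([Q^(t) π_{-i}^(t)] - [Q^(t) π^(t)] 1)` of the algorithm with
`Q`-updates; `u^(0) = 0`. -/
noncomputable def qRegretVec (G : MarkovGame N H S A) (π : PolicySeq H S A) (i : Fin N)
    (h : Fin H) (s : S) (t : ℕ) (b : A i) : ℝ :=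
  if t = 0 then 0 else
    utilWeight H t *
      (meanOthers (G.qIter π t i h.castSucc s) (fun j => π t j h s) i b
        - meanJoint (G.qIter π t i h.castSucc s) (fun j => π t j h s))

/-- `π` is the sequence of policies played when every player runs MG-DLRC-OMWU with `V`-updates
for `T` rounds, with regularization parameter `α` and base learning rate `η`: in each round, each
policy is the softmax of `λ R^(t)`, where `λ` maximizes the learning-rate objective. -/
def IsOMWURun (G : MarkovGame N H S A) (T : ℕ) (α η : ℝ) (π : PolicySeq H S A) : Prop :=
  ∀ t, 1 ≤ t → t ≤ T → ∀ (i : Fin N) (h : Fin H) (s : S),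
    ∃ lam ∈ Set.Ioc (0 : ℝ) 1,
      IsMaxOn (rateObjective α (optimisticSignal H η (G.vRegretVec π i h s) t))
        (Set.Ioc (0 : ℝ) 1) lam ∧
      ∀ b, π t i h s b =
        Real.exp (lam * optimisticSignal H η (G.vRegretVec π i h s) t b) /
          ∑ c, Real.exp (lam * optimisticSignal H η (G.vRegretVec π i h s) t c)

/-- `π` is the sequence of policies played when every player runs MG-DLRC-OFTRL (with `Q`-updates)
for `T` rounds, with regularization parameter `α` and base learning rate `η`: in each round, each
policy is the normalization of a maximizer of the regularized objective over `(0, 1] Δ`. -/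
def IsOFTRLRun (G : MarkovGame N H S A) (T : ℕ) (α η : ℝ) (π : PolicySeq H S A) : Prop :=
  ∀ t, 1 ≤ t → t ≤ T → ∀ (i : Fin N) (h : Fin H) (s : S),
    ∃ y ∈ liftedSimplex (A i),
      IsMaxOn (fun z : A i → ℝ =>
          ∑ b, optimisticSignal H η (G.qRegretVec π i h s) t b * z b - regularizer α z)
        (liftedSimplex (A i)) y ∧
      ∀ b, π t i h s b = y b / ∑ c, y c

end MarkovGame

/-! ### Weights -/

/-! Write a point of the lifted simplex as `y = l • x` with `x` a mixed action. The OFTRL objective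
becomes `l⟨R, x⟩ + (α - 1) log l - ∑ x log x`. For fixed `l` it is maximal at the softmax of `l R`,
with value `rateObjective`, and the deficit of any other `x` is a KL divergence. Hence the OFTRL and
OMWU steps agree for equal signals (`exists_liftedSimplex_isMaxOn_iff`). The signals agree because
`Q^(t) = r + P V^(t)` for `t ≥ 1` (`qIter_eq_stagePayoff`).

The analytic core is `liftedObjective_growth`: away from the maximizer the objective drops by at
least a multiple of the squared Hellinger distance of the mixed actions plus the squared change of
learning rate. Rate and mixed action interact only through the entropy difference, which is at most
`5.1 L` times the Hellinger distance, where `L` is the logarithm of the number of actions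
(`abs_entropy_sub_le`). The `70 L²` in `α` absorbs this cross term.

Growth makes a potential argument for optimistic FTRL work (`weighted_regret_le`): weighted regret
plus squared path length is at most the regularizer at the comparator plus squared prediction
errors. The prediction error of one player is controlled by the movement of all players and by the
drift `α_t H` of the values.

Comparators may be scaled down to `l • e_a`. With `l = 1/t` the regret is trivially at least `-H
w_t`, at a regularization cost of order `α log t`. Thus no regret can be very negative, and summing
over players bounds the total path length. Inserting that bound with `l = 1` gives every player
regret of order `α log t` in every state (`sum_weighted_gain_le_of_isOMWURun`), hence averaged
regret at most `C / t`.

Finally, backward induction along the chain of round indices (`chain_expect_le`) compares the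
roll-out policy and its deviations with `V^(T)`. Each step adds a regret `C / t`. Averaging `1 / j`
under the weights `α_t^j` costs only a factor `1 + 1/H`, and this compounds to at most `e` over `H`
steps. -/

theorem one_sub_stepSize_succ (H t : ℕ) :
    1 - stepSize H (t + 1) = (t : ℝ) / ((H : ℝ) + t + 1) := by
  unfold stepSize
  have h : (H : ℝ) + (t + 1) ≠ 0 := by positivity
  have h' : (H : ℝ) + t + 1 ≠ 0 := by positivity
  push_cast
  field_simp
  ring

theorem stepSize_one (H : ℕ) : stepSize H 1 = 1 := by
  unfold stepSize
  have h : (H : ℝ) + 1 ≠ 0 := by positivity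
  simp [h]

theorem stepSize_pos (H t : ℕ) (ht : 1 ≤ t) : 0 < stepSize H t := by
  unfold stepSize
  have : (1 : ℝ) ≤ t := by exact_mod_cast ht
  positivity

theorem avgWeight_one_pos (H t : ℕ) (ht : 1 ≤ t) : 0 < avgWeight H t 1 := by
  induction t, ht using Nat.le_induction with
  | base => rw [avgWeight_self H 1 le_rfl, stepSize_one]; exact one_pos
  | succ t ht ih =>
    rw [avgWeight_succ H t 1 ht, one_sub_stepSize_succ]
    have : (1 : ℝ) ≤ t := by exact_mod_cast ht
    positivity

theorem utilWeight_zero (H : ℕ) : utilWeight H 0 = 0 := by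
  simp [utilWeight, avgWeight]

theorem utilWeight_pos (H t : ℕ) (ht : 1 ≤ t) : 0 < utilWeight H t := by
  unfold utilWeight
  rw [avgWeight_self H t ht]
  exact div_pos (stepSize_pos H t ht) (avgWeight_one_pos H t ht)

theorem avgWeight_one_mul_utilWeight (H t : ℕ) (ht : 1 ≤ t) :
    avgWeight H t 1 * utilWeight H t = stepSize H t := by
  unfold utilWeight
  rw [avgWeight_self H t ht, mul_div_cancel₀ _ (avgWeight_one_pos H t ht).ne']

/-- All weights `α_t^j` acquire the same factor `1 - α_{t+1}` in the next round, so their ratios do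
not depend on `t`. This turns an average with weights `α_t^j` into a cumulative sum with the fixed
weights `w_j`. -/
theorem avgWeight_eq_mul_utilWeight (H t j : ℕ) (hj : 1 ≤ j) (hjt : j ≤ t) :
    avgWeight H t j = avgWeight H t 1 * utilWeight H j := by
  induction t, hjt using Nat.le_induction with
  | base => rw [avgWeight_one_mul_utilWeight H j hj, avgWeight_self H j hj]
  | succ t ht ih =>
    rw [avgWeight_succ H t j ht, ih, avgWeight_succ H t 1 (hj.trans ht), mul_assoc]

theorem utilWeight_succ (H t : ℕ) (ht : 1 ≤ t) :
    utilWeight H (t + 1) = ((H : ℝ) + t) / t * utilWeight H t := by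
  have h1 := avgWeight_one_mul_utilWeight H t ht
  have h2 := avgWeight_one_mul_utilWeight H (t + 1) (by omega)
  have h3 := avgWeight_one_pos H t ht
  rw [avgWeight_succ H t 1 ht, one_sub_stepSize_succ] at h2
  have ht' : (1 : ℝ) ≤ t := by exact_mod_cast ht
  have e1 : utilWeight H t = stepSize H t / avgWeight H t 1 := by
    rw [eq_div_iff h3.ne', mul_comm, h1]
  have hne : (t : ℝ) / (H + t + 1) * avgWeight H t 1 ≠ 0 := by positivity
  have e2 : utilWeight H (t + 1) = stepSize H (t + 1) / (t / (H + t + 1) * avgWeight H t 1) := by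
    rw [eq_div_iff hne, mul_comm, h2]
  rw [e1, e2]
  unfold stepSize
  push_cast
  have a1 : (t : ℝ) ≠ 0 := by positivity
  have a2 : (H : ℝ) + t ≠ 0 := by positivity
  have a3 : (H : ℝ) + (t + 1) ≠ 0 := by positivity
  have a4 : (H : ℝ) + t + 1 ≠ 0 := by positivity
  field_simp
  ring

theorem utilWeight_le_succ (H t : ℕ) : utilWeight H t ≤ utilWeight H (t + 1) := by
  rcases Nat.eq_zero_or_pos t with rfl | ht
  · rw [utilWeight_zero]; exact (utilWeight_pos H 1 le_rfl).le
  · rw [utilWeight_succ H t ht]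
    have ht' : (1 : ℝ) ≤ t := by exact_mod_cast ht
    have : (1 : ℝ) ≤ ((H : ℝ) + t) / t := by
      rw [le_div_iff₀ (by positivity)]
      have : (0 : ℝ) ≤ H := Nat.cast_nonneg H
      linarith
    exact le_mul_of_one_le_left (utilWeight_pos H t ht).le this

theorem utilWeight_mono (H : ℕ) : Monotone (utilWeight H) :=
  monotone_nat_of_le_succ (utilWeight_le_succ H)

theorem utilWeight_succ_le (H t : ℕ) (hH : 1 ≤ H) (ht : 1 ≤ t) :
    utilWeight H (t + 1) ≤ 2 * H * utilWeight H t := by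
  rw [utilWeight_succ H t ht]
  refine mul_le_mul_of_nonneg_right ?_ (utilWeight_pos H t ht).le
  have ht' : (1 : ℝ) ≤ t := by exact_mod_cast ht
  have hH' : (1 : ℝ) ≤ H := by exact_mod_cast hH
  rw [div_le_iff₀ (by positivity)]
  nlinarith

theorem avgWeight_one_le (H t : ℕ) (hH : 1 ≤ H) (ht : 1 ≤ t) :
    avgWeight H t 1 * utilWeight H t ≤ 2 * H / t := by
  rw [avgWeight_one_mul_utilWeight H t ht]
  have ht' : (1 : ℝ) ≤ t := by exact_mod_cast ht
  have hH' : (1 : ℝ) ≤ H := by exact_mod_cast hH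
  unfold stepSize
  rw [div_le_div_iff₀ (by positivity) (by positivity)]
  nlinarith

theorem sum_utilWeight_le (H t : ℕ) :
    ∑ j ∈ Finset.Ico 1 (t + 1), utilWeight H j ≤ t * utilWeight H t := by
  rw [Finset.sum_Ico_eq_sum_range]
  calc ∑ j ∈ Finset.range (t + 1 - 1), utilWeight H (1 + j)
      ≤ ∑ _j ∈ Finset.range (t + 1 - 1), utilWeight H t := by
        refine Finset.sum_le_sum fun j hj => utilWeight_mono H ?_
        have := Finset.mem_range.mp hj
        omega
    _ = t * utilWeight H t := by simp

/-- The right-hand side satisfies the recursion of the left-hand side with equality, so only `t = 1`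
loses anything. The factor `1 + 1/H` is what one step of the chain of round indices costs. -/
theorem sum_avgWeight_div_le (H t : ℕ) (hH : 1 ≤ H) (ht : 1 ≤ t) :
    ∑ j ∈ Finset.range t, avgWeight H t (j + 1) / ((j : ℝ) + 1) ≤ (1 + 1 / (H : ℝ)) / t := by
  have hH' : (1 : ℝ) ≤ H := by exact_mod_cast hH
  induction t, ht using Nat.le_induction with
  | base =>
    simp [avgWeight_self, stepSize_one]
  | succ t ht ih =>
    have ht' : (1 : ℝ) ≤ t := by exact_mod_cast ht
    rw [Finset.sum_range_succ, avgWeight_self H (t + 1) (by omega),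
      Finset.sum_congr rfl (fun j hj => by
        rw [avgWeight_succ H t (j + 1) (by have := Finset.mem_range.mp hj; omega), mul_div_assoc]),
      ← Finset.mul_sum, one_sub_stepSize_succ]
    refine (add_le_add_left (mul_le_mul_of_nonneg_left ih (by positivity)) _).trans (le_of_eq ?_)
    unfold stepSize
    push_cast
    have a3 : (H : ℝ) + (t + 1) ≠ 0 := by positivity
    have a4 : (H : ℝ) + t + 1 ≠ 0 := by positivity
    field_simp
    ring

theorem sum_stepSize_sq_le (H t : ℕ) (hH : 1 ≤ H) :
    ∑ j ∈ Finset.Ico 1 t, stepSize H j ^ 2 ≤ 4 * H := by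
  have hH' : (1 : ℝ) ≤ H := by exact_mod_cast hH
  -- Telescoping: `1/(H+n+1)²` is at most `1/(H+n) - 1/(H+n+1)`.
  have key : ∀ n : ℕ, ∑ j ∈ Finset.range n, stepSize H (1 + j) ^ 2 ≤
      ((H : ℝ) + 1) ^ 2 * (1 / H - 1 / (H + n)) := by
    intro n
    induction n with
    | zero => simp
    | succ n ih =>
      rw [Finset.sum_range_succ]
      have : stepSize H (1 + n) ^ 2 ≤
          ((H : ℝ) + 1) ^ 2 * (1 / (H + n) - 1 / (H + (n + 1 : ℕ))) := by
        unfold stepSize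
        push_cast
        rw [div_pow, div_eq_mul_inv]
        refine mul_le_mul_of_nonneg_left ?_ (by positivity)
        have b1 : (0 : ℝ) < H + n := by positivity
        have b2 : (0 : ℝ) < H + (n + 1) := by positivity
        rw [div_sub_div _ _ b1.ne' b2.ne', show (H : ℝ) + (1 + n) = H + (n + 1) by ring,
          inv_eq_one_div, div_le_div_iff₀ (by positivity) (by positivity)]
        nlinarith
      linarith
  rw [Finset.sum_Ico_eq_sum_range]
  have h0 : (0 : ℝ) ≤ 1 / (H + (t - 1 : ℕ)) := by positivity
  have h1 : ((H : ℝ) + 1) ^ 2 * (1 / (H : ℝ) - 1 / (H + (t - 1 : ℕ)))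
      ≤ ((H : ℝ) + 1) ^ 2 * (1 / (H : ℝ)) :=
    mul_le_mul_of_nonneg_left (by linarith) (by positivity)
  have h2 : ((H : ℝ) + 1) ^ 2 * (1 / (H : ℝ)) ≤ 4 * H := by
    rw [mul_one_div, div_le_iff₀ (by positivity)]
    nlinarith
  exact (key _).trans (h1.trans h2)

/-! ### Entropy, the softmax, and the lifted simplex -/

section Softmax

variable {B : Type*} [Fintype B]

/-- The squared Hellinger distance `∑ (√y - √x)²`. -/
noncomputable def hellingerSq (x y : B → ℝ) : ℝ := ∑ b, (√(y b) - √(x b)) ^ 2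

/-- The softmax of `lam * R`. -/
noncomputable def softmax (lam : ℝ) (R : B → ℝ) (b : B) : ℝ :=
  Real.exp (lam * R b) / ∑ c, Real.exp (lam * R c)

theorem hellingerSq_nonneg (x y : B → ℝ) : 0 ≤ hellingerSq x y :=
  Finset.sum_nonneg fun _ _ => sq_nonneg _

theorem hellingerSq_eq {x y : B → ℝ} (hx : ∀ b, 0 ≤ x b) (hy : ∀ b, 0 ≤ y b)
    (hx1 : ∑ b, x b = 1) (hy1 : ∑ b, y b = 1) :
    hellingerSq x y = 2 - 2 * ∑ b, √(y b) * √(x b) := by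
  unfold hellingerSq
  have h : ∀ b, (√(y b) - √(x b)) ^ 2 = y b + x b - 2 * (√(y b) * √(x b)) := fun b => by
    rw [sub_sq, Real.sq_sqrt (hx b), Real.sq_sqrt (hy b)]; ring
  simp only [h]
  rw [Finset.sum_sub_distrib, Finset.sum_add_distrib, hx1, hy1, ← Finset.mul_sum]
  norm_num

/-- This is `log u ≤ u - 1` at `u = √b / √a`. Summed over the actions it bounds the KL divergence
below by the squared Hellinger distance. -/
theorem mul_log_sub_mul_log_ge {a b : ℝ} (ha : 0 ≤ a) (hb : 0 < b) :
    2 * (a - √a * √b) ≤ a * Real.log a - a * Real.log b := by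
  rcases ha.eq_or_lt with rfl | ha
  · simp
  · have hsa := Real.sqrt_pos.mpr ha
    have hsb := Real.sqrt_pos.mpr hb
    have h := Real.log_le_sub_one_of_pos (div_pos hsb hsa)
    rw [Real.log_div hsb.ne' hsa.ne', Real.log_sqrt hb.le, Real.log_sqrt ha.le] at h
    have h2 := mul_le_mul_of_nonneg_left h ha.le
    have h3 : a * (√b / √a - 1) = √a * √b - a := by
      have : a = √a * √a := (Real.mul_self_sqrt ha.le).symm
      rw [mul_sub, mul_one, mul_div_assoc']
      nth_rw 1 [this]
      field_simp
    rw [h3] at h2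
    linarith

theorem hellingerSq_le_kl {x p : B → ℝ} (hx : ∀ b, 0 ≤ x b) (hp : ∀ b, 0 < p b)
    (hx1 : ∑ b, x b = 1) (hp1 : ∑ b, p b = 1) :
    hellingerSq p x ≤ ∑ b, x b * Real.log (x b) - ∑ b, x b * Real.log (p b) := by
  rw [hellingerSq_eq (fun b => (hp b).le) hx hp1 hx1, ← Finset.sum_sub_distrib]
  refine le_trans (le_of_eq ?_)
    (Finset.sum_le_sum fun b _ => mul_log_sub_mul_log_ge (hx b) (hp b))
  rw [← Finset.mul_sum, Finset.sum_sub_distrib, hx1]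
  ring

theorem eq_of_hellingerSq_eq_zero {x y : B → ℝ} (hx : ∀ b, 0 ≤ x b) (hy : ∀ b, 0 ≤ y b)
    (h : hellingerSq x y = 0) (b : B) : y b = x b := by
  have h1 := (Finset.sum_eq_zero_iff_of_nonneg fun b _ => sq_nonneg _).mp h b (Finset.mem_univ b)
  have h2 : √(y b) = √(x b) := sub_eq_zero.mp (pow_eq_zero_iff two_ne_zero |>.mp h1)
  exact (Real.sqrt_inj (hy b) (hx b)).mp h2

/-- The objective of the lifted problem at the point `lam • x`. -/
noncomputable def liftedObjective (α : ℝ) (R : B → ℝ) (lam : ℝ) (x : B → ℝ) : ℝ :=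
  lam * ∑ b, R b * x b + (α - 1) * Real.log lam - ∑ b, x b * Real.log (x b)

/-- The normalized entropy term of `lam • x` contributes an extra `log lam`, which lowers the
coefficient `α` to `α - 1`. -/
theorem liftedObjective_eq (α : ℝ) (R : B → ℝ) {lam : ℝ} (hlam : 0 < lam) {x : B → ℝ}
    (hx1 : ∑ b, x b = 1) :
    ∑ b, R b * (lam * x b) - regularizer α (fun b => lam * x b) = liftedObjective α R lam x := by
  unfold regularizer liftedObjective
  have h1 : ∑ b, lam * x b = lam := by rw [← Finset.mul_sum, hx1, mul_one]
  have h2 : ∑ b, lam * x b * Real.log (lam * x b)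
      = lam * Real.log lam + lam * ∑ b, x b * Real.log (x b) := by
    have : ∀ b, lam * x b * Real.log (lam * x b)
        = lam * Real.log lam * x b + lam * (x b * Real.log (x b)) := fun b => by
      rcases eq_or_ne (x b) 0 with h | h
      · simp [h]
      · rw [Real.log_mul hlam.ne' h]; ring
    simp only [this]
    rw [Finset.sum_add_distrib, ← Finset.mul_sum, ← Finset.mul_sum, hx1, mul_one]
  have h3 : ∑ b, R b * (lam * x b) = lam * ∑ b, R b * x b := by
    rw [Finset.mul_sum]
    exact Finset.sum_congr rfl fun b _ => by ring
  rw [h1, h2, h3]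
  field_simp
  ring

theorem smul_mem_liftedSimplex {lam : ℝ} (hlam : lam ∈ Set.Ioc (0 : ℝ) 1) {x : B → ℝ}
    (hx : ∀ b, 0 ≤ x b) (hx1 : ∑ b, x b = 1) : (fun b => lam * x b) ∈ liftedSimplex B := by
  refine ⟨fun b => mul_nonneg hlam.1.le (hx b), ?_, ?_⟩ <;>
  · rw [← Finset.mul_sum, hx1, mul_one]
    first | exact hlam.1 | exact hlam.2

theorem exists_smul_of_mem_liftedSimplex {y : B → ℝ} (hy : y ∈ liftedSimplex B) :
    ∃ lam ∈ Set.Ioc (0 : ℝ) 1, ∃ x : B → ℝ, (∀ b, 0 ≤ x b) ∧ ∑ b, x b = 1 ∧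
      (∀ b, x b = y b / ∑ c, y c) ∧ y = fun b => lam * x b := by
  obtain ⟨h0, h1, h2⟩ := hy
  refine ⟨∑ c, y c, ⟨h1, h2⟩, fun b => y b / ∑ c, y c, fun b => div_nonneg (h0 b) h1.le, ?_,
    fun b => rfl, ?_⟩
  · rw [← Finset.sum_div, div_self h1.ne']
  · funext b
    rw [mul_div_cancel₀ _ h1.ne']

variable [Nonempty B]

theorem sum_exp_pos (f : B → ℝ) : 0 < ∑ b, Real.exp (f b) :=
  Finset.sum_pos (fun _ _ => Real.exp_pos _) Finset.univ_nonempty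

theorem softmax_pos (lam : ℝ) (R : B → ℝ) (b : B) : 0 < softmax lam R b :=
  div_pos (Real.exp_pos _) (sum_exp_pos _)

theorem sum_softmax (lam : ℝ) (R : B → ℝ) : ∑ b, softmax lam R b = 1 := by
  unfold softmax
  rw [← Finset.sum_div, div_self (sum_exp_pos _).ne']

theorem log_softmax (lam : ℝ) (R : B → ℝ) (b : B) :
    Real.log (softmax lam R b) = lam * R b - Real.log (∑ c, Real.exp (lam * R c)) := by
  unfold softmax
  rw [Real.log_div (Real.exp_pos _).ne' (sum_exp_pos _).ne', Real.log_exp]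

theorem sum_mul_log_softmax (lam : ℝ) (R : B → ℝ) {x : B → ℝ} (hx1 : ∑ b, x b = 1) :
    ∑ b, x b * Real.log (softmax lam R b)
      = lam * ∑ b, R b * x b - Real.log (∑ c, Real.exp (lam * R c)) := by
  simp only [log_softmax, mul_sub]
  rw [Finset.sum_sub_distrib, ← Finset.sum_mul, hx1, one_mul, Finset.mul_sum]
  congr 1
  exact Finset.sum_congr rfl fun b _ => by ring

theorem liftedObjective_softmax (α : ℝ) (R : B → ℝ) (lam : ℝ) :
    liftedObjective α R lam (softmax lam R) = rateObjective α R lam := by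
  unfold liftedObjective rateObjective
  rw [sum_mul_log_softmax lam R (sum_softmax lam R)]
  ring

/-- Gibbs variational principle: the deficit of `x` against the softmax is exactly the KL divergence
of `x` from it. Keeping the Hellinger term also gives uniqueness of the maximizing mixed action. -/
theorem liftedObjective_le (α : ℝ) (R : B → ℝ) (lam : ℝ) {x : B → ℝ}
    (hx : ∀ b, 0 ≤ x b) (hx1 : ∑ b, x b = 1) :
    liftedObjective α R lam x + hellingerSq (softmax lam R) x ≤ rateObjective α R lam := by
  have h := hellingerSq_le_kl hx (softmax_pos lam R) hx1 (sum_softmax lam R)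
  rw [sum_mul_log_softmax lam R hx1] at h
  unfold liftedObjective rateObjective
  linarith

/-- The optimistic FTRL step over `(0, 1] Δ` is the softmax step with the dynamic learning
rate. -/
theorem exists_liftedSimplex_isMaxOn_iff (α : ℝ) (R : B → ℝ) (x : B → ℝ) :
    (∃ y ∈ liftedSimplex B,
      IsMaxOn (fun z : B → ℝ => ∑ b, R b * z b - regularizer α z) (liftedSimplex B) y ∧
      ∀ b, x b = y b / ∑ c, y c) ↔
    ∃ lam ∈ Set.Ioc (0 : ℝ) 1, IsMaxOn (rateObjective α R) (Set.Ioc (0 : ℝ) 1) lam ∧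
      ∀ b, x b = softmax lam R b := by
  constructor
  · rintro ⟨y, hy, hmax, hx⟩
    obtain ⟨lam, hlam, p, hp, hp1, hpy, rfl⟩ := exists_smul_of_mem_liftedSimplex hy
    have hle : ∀ l ∈ Set.Ioc (0 : ℝ) 1, rateObjective α R l ≤ liftedObjective α R lam p := by
      intro l hl
      have h := hmax (smul_mem_liftedSimplex hl (fun b => (softmax_pos l R b).le)
        (sum_softmax l R))
      simp only [Set.mem_ofPred_eq] at h
      rwa [liftedObjective_eq α R hl.1 (sum_softmax l R), liftedObjective_eq α R hlam.1 hp1,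
        liftedObjective_softmax] at h
    have hG := liftedObjective_le α R lam hp hp1
    have h0 : hellingerSq (softmax lam R) p = 0 :=
      le_antisymm (by linarith [hle lam hlam]) (hellingerSq_nonneg _ _)
    have heq := eq_of_hellingerSq_eq_zero (fun b => (softmax_pos lam R b).le) hp h0
    refine ⟨lam, hlam, fun l hl => (hle l hl).trans (by
      show _ ≤ rateObjective α R lam
      linarith [hellingerSq_nonneg (softmax lam R) p]), fun b => ?_⟩
    rw [hx b, ← hpy b, heq b]
  · rintro ⟨lam, hlam, hmax, hx⟩
    have h1 := sum_softmax lam R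
    refine ⟨fun b => lam * softmax lam R b,
      smul_mem_liftedSimplex hlam (fun b => (softmax_pos lam R b).le) h1, ?_, fun b => ?_⟩
    · intro z hz
      obtain ⟨l, hl, p, hp, hp1, -, rfl⟩ := exists_smul_of_mem_liftedSimplex hz
      simp only [Set.mem_ofPred_eq]
      rw [liftedObjective_eq α R hl.1 hp1, liftedObjective_eq α R hlam.1 h1,
        liftedObjective_softmax]
      have h2 := liftedObjective_le α R l hp hp1
      have h3 : rateObjective α R l ≤ rateObjective α R lam := hmax hl
      linarith [hellingerSq_nonneg (softmax l R) p]
    · rw [← Finset.mul_sum, h1, mul_one, mul_div_cancel_left₀ _ hlam.1.ne', hx b]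

theorem exists_isMaxOn_rateObjective {α : ℝ} (hα : 1 < α) (R : B → ℝ) :
    ∃ lam ∈ Set.Ioc (0 : ℝ) 1, IsMaxOn (rateObjective α R) (Set.Ioc (0 : ℝ) 1) lam := by
  set C := Real.log (∑ b, Real.exp |R b|) with hC
  -- Since `α > 1`, the term `(α - 1) log l` tends to `-∞` at `0`, while the log-sum-exp term stays
  -- below `C`. The cutoff `exp m` is chosen so that below it the objective does not exceed its
  -- value at `1`; on `[exp m, 1]` compactness applies.
  set m := min 0 ((rateObjective α R 1 - C) / (α - 1)) with hm
  have hε : Real.exp m ≤ 1 := Real.exp_le_one_iff.mpr (min_le_left _ _)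
  have hcont : ContinuousOn (rateObjective α R) (Set.Icc (Real.exp m) 1) := by
    unfold rateObjective
    refine ContinuousOn.add (continuousOn_const.mul (Real.continuousOn_log.mono ?_)) ?_
    · intro l hl
      exact ((Real.exp_pos m).trans_le hl.1).ne'
    · refine (Continuous.log (by fun_prop) fun l => (sum_exp_pos _).ne').continuousOn
  obtain ⟨lam, hlam, hmax⟩ := isCompact_Icc.exists_isMaxOn
    ⟨1, hε, le_rfl⟩ hcont
  refine ⟨lam, ⟨(Real.exp_pos m).trans_le hlam.1, hlam.2⟩, fun l hl => ?_⟩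
  rcases le_or_gt (Real.exp m) l with h | h
  · exact hmax ⟨h, hl.2⟩
  · have h1 : rateObjective α R 1 ≤ rateObjective α R lam := hmax ⟨hε, le_rfl⟩
    refine le_trans ?_ h1
    have h1 : Real.log l ≤ (rateObjective α R 1 - C) / (α - 1) :=
      ((Real.log_le_iff_le_exp hl.1).mpr h.le).trans (min_le_right _ _)
    rw [le_div_iff₀ (by linarith)] at h1
    have h2 : Real.log (∑ b, Real.exp (l * R b)) ≤ C := by
      refine Real.log_le_log (sum_exp_pos _) (Finset.sum_le_sum fun b _ => Real.exp_le_exp.mpr ?_)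
      calc l * R b ≤ |l * R b| := le_abs_self _
        _ = l * |R b| := by rw [abs_mul, abs_of_pos hl.1]
        _ ≤ |R b| := mul_le_of_le_one_left (abs_nonneg _) hl.2
    show (α - 1) * Real.log l + Real.log (∑ b, Real.exp (l * R b)) ≤ rateObjective α R 1
    linarith

end Softmax

/-! ### A lower bound on the growth of the regularized objective -/

/-- The first two terms of the power series of `-log (1 - x)` at `x = 1 - r`. -/
theorem half_sq_le_sub_log {r : ℝ} (hr : 0 < r) (hr1 : r ≤ 1) :
    (1 - r) ^ 2 / 2 ≤ r - 1 - Real.log r := by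
  have h := Real.hasSum_pow_div_log_of_abs_lt_one (x := 1 - r)
    (by rw [abs_of_nonneg (by linarith)]; linarith)
  have h2 := sum_le_hasSum (Finset.range 2) (fun n _ => by
    have : 0 ≤ 1 - r := by linarith
    positivity) h
  rw [Finset.sum_range_succ, Finset.sum_range_one] at h2
  norm_num at h2
  linarith

/-- This is `x ≤ sinh x` at `x = log r`. -/
theorem half_sq_div_le_sub_log {r : ℝ} (hr : 1 ≤ r) :
    (r - 1) ^ 2 / (2 * r) ≤ r - 1 - Real.log r := by
  have h0 : 0 < r := by linarith
  have h := Real.self_le_sinh_iff.mpr (Real.log_nonneg hr)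
  rw [Real.sinh_log h0] at h
  have : (r - 1) ^ 2 / (2 * r) = r - 1 - (r - r⁻¹) / 2 := by field_simp; ring
  linarith

theorem neg_mul_log_le {a : ℝ} (ha : 0 < a) : -(a * Real.log a) ≤ 0.37 := by
  have he := Real.exp_one_gt_d9
  have h := Real.log_le_sub_one_of_pos (show 0 < (a * Real.exp 1)⁻¹ by positivity)
  rw [Real.log_inv, Real.log_mul ha.ne' (Real.exp_pos 1).ne', Real.log_exp] at h
  have h1 : -(a * Real.log a) ≤ a * (a * Real.exp 1)⁻¹ := by nlinarith
  have h2 : a * (a * Real.exp 1)⁻¹ = (Real.exp 1)⁻¹ := by field_simp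
  rw [h2] at h1
  refine h1.trans ?_
  rw [inv_le_comm₀ (Real.exp_pos 1) (by norm_num)]
  norm_num
  linarith

/-- Split at `r = exp (-L/2)`. Above it `|log r| ≤ L/2`. Below it, `a = r exp (L/2) < 1` has `|a log
a| ≤ 1/e ≤ 0.37`, and `2 · 0.37² ≤ 0.275`. The error `exp (-L)` is small enough to be summed over
all actions. -/
theorem sq_mul_log_sq_le {r L : ℝ} (hr : 0 < r) (hr1 : r ≤ 1) (hL : 0 ≤ L) :
    (r * Real.log r) ^ 2 ≤ 1 / 2 * r ^ 2 * L ^ 2 + 0.275 * Real.exp (-L) := by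
  set a := r * Real.exp (L / 2) with ha
  have ha0 : 0 < a := by positivity
  have hlog : Real.log a = Real.log r + L / 2 := by
    rw [ha, Real.log_mul hr.ne' (Real.exp_pos _).ne', Real.log_exp]
  have hlr : Real.log r ≤ 0 := Real.log_nonpos hr.le hr1
  have hexp : 0 < Real.exp (-L) := Real.exp_pos _
  rcases le_or_gt 1 a with h | h
  · have h1 : 0 ≤ Real.log r + L / 2 := hlog ▸ Real.log_nonneg h
    have h2 : Real.log r ^ 2 ≤ L ^ 2 / 4 := by nlinarith
    have h3 := mul_le_mul_of_nonneg_left h2 (sq_nonneg r)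
    rw [mul_pow]
    nlinarith [mul_nonneg (sq_nonneg r) (sq_nonneg L)]
  · have h1 := neg_mul_log_le ha0
    have h0 : 0 ≤ -(a * Real.log a) := by
      have := Real.log_nonpos ha0.le h.le
      nlinarith
    have h2 : (a * Real.log a) ^ 2 ≤ 0.37 ^ 2 := by nlinarith
    have h3 : (a * Real.log a) ^ 2 * Real.exp (-L) = (r * (Real.log r + L / 2)) ^ 2 := by
      have : Real.exp (-L) = (Real.exp (L / 2) ^ 2)⁻¹ := by
        rw [← Real.exp_nat_mul, ← Real.exp_neg]
        congr 1
        push_cast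
        ring
      rw [this, hlog, ha]
      field_simp
    have h4 := mul_le_mul_of_nonneg_right h2 hexp.le
    rw [h3] at h4
    have h5 : (r * Real.log r) ^ 2 ≤ 2 * (r * (Real.log r + L / 2)) ^ 2 + 2 * (r * (L / 2)) ^ 2 := by
      nlinarith [sq_nonneg (r * (Real.log r + L / 2) + r * (L / 2))]
    nlinarith

theorem sq_sub_mul_log_sub_le {x y L : ℝ} (hx : 0 < x) (hy : 0 < y) (hx1 : x ≤ 1) (hy1 : y ≤ 1)
    (hL : 0 ≤ L) :
    ((y - y * Real.log y) - (x - x * Real.log x)) ^ 2 ≤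
      (8 * (x + y) * L ^ 2 + 4.4 * Real.exp (-L)) * (√y - √x) ^ 2 := by
  wlog hxy : x ≤ y generalizing x y
  · have := this hy hx hy1 hx1 (le_of_not_ge hxy)
    calc _ = ((x - x * Real.log x) - (y - y * Real.log y)) ^ 2 := by ring
      _ ≤ _ := this
      _ = _ := by ring
  rcases hxy.eq_or_lt with rfl | hxy
  · simp
  -- In the square-root variable the function `z - z log z` has derivative `-4 p log p`: the linear
  -- term `z` is there to cancel the part without logarithm. The mean value theorem then yields the
  -- factor `√y - √x`.
  set f : ℝ → ℝ := fun p => p ^ 2 - 2 * p ^ 2 * Real.log p with hf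
  have hfs : ∀ z, 0 < z → f (√z) = z - z * Real.log z := fun z hz => by
    simp only [hf, Real.sq_sqrt hz.le, Real.log_sqrt hz.le]; ring
  have hp : 0 < √x := Real.sqrt_pos.mpr hx
  have hpq : √x < √y := Real.sqrt_lt_sqrt hx.le hxy
  have hder : ∀ p, 0 < p → HasDerivAt f (-4 * (p * Real.log p)) p := fun p hp => by
    have h1 := (hasDerivAt_pow 2 p).sub
      (((hasDerivAt_pow 2 p).const_mul 2).mul (Real.hasDerivAt_log hp.ne'))
    exact h1.congr_deriv (by push_cast; field_simp; ring)
  obtain ⟨r, hr, hslope⟩ := exists_hasDerivAt_eq_slope f (fun p => -4 * (p * Real.log p)) hpq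
    (fun p hp' => (hder p (hp.trans_le hp'.1)).continuousAt.continuousWithinAt)
    (fun p hp' => hder p (hp.trans hp'.1))
  rw [eq_div_iff (sub_pos.mpr hpq).ne', hfs x hx, hfs y hy] at hslope
  have hr0 : 0 < r := hp.trans hr.1
  have hr2 : r ^ 2 ≤ y := by
    rw [← Real.sq_sqrt hy.le]
    exact pow_le_pow_left₀ hr0.le hr.2.le 2
  have hr1 : r ≤ 1 := hr.2.le.trans (Real.sqrt_le_one.mpr hy1)
  rw [← hslope, mul_pow]
  refine mul_le_mul_of_nonneg_right ?_ (sq_nonneg _)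
  have h := sq_mul_log_sq_le hr0 hr1 hL
  have h2 : r ^ 2 * L ^ 2 ≤ (x + y) * L ^ 2 :=
    mul_le_mul_of_nonneg_right (by linarith) (sq_nonneg L)
  nlinarith [Real.exp_pos (-L)]

section Growth

variable {B : Type*} [Fintype B]

theorem le_one_of_sum_eq_one {x : B → ℝ} (hx : ∀ b, 0 ≤ x b) (hx1 : ∑ b, x b = 1) (b : B) :
    x b ≤ 1 :=
  hx1 ▸ Finset.single_le_sum (fun c _ => hx c) (Finset.mem_univ b)

/-- Cauchy–Schwarz over the actions applied to the pointwise bound. The first factor sums to at most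
`16 L² + 4.4`, because `exp L` is at least the number of actions, and this is below `(5.1 L)²` since
`L ≥ log 2`. -/
theorem abs_entropy_sub_le {x y : B → ℝ} {L : ℝ} (hx : ∀ b, 0 < x b) (hy : ∀ b, 0 < y b)
    (hx1 : ∑ b, x b = 1) (hy1 : ∑ b, y b = 1) (hL2 : Real.log 2 ≤ L)
    (hL : Real.log (Fintype.card B) ≤ L) :
    |∑ b, y b * Real.log (y b) - ∑ b, x b * Real.log (x b)| ≤ 5.1 * L * √(hellingerSq x y) := by
  have hl2 := Real.log_two_gt_d9
  have hL0 : 0.693 ≤ L := by linarith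
  refine abs_le_of_sq_le_sq ?_ (by positivity)
  have hh := hellingerSq_nonneg x y
  rw [mul_pow, Real.sq_sqrt hh]
  have hd : (Fintype.card B : ℝ) * Real.exp (-L) ≤ 1 := by
    rcases Nat.eq_zero_or_pos (Fintype.card B) with h | h
    · rw [h]; simp
    · have hc : (0 : ℝ) < Fintype.card B := by exact_mod_cast h
      rw [Real.exp_neg, ← div_eq_mul_inv, div_le_one (Real.exp_pos _)]
      exact (Real.log_le_iff_le_exp hc).mp hL
  have key := Finset.sum_sq_le_sum_mul_sum_of_sq_le_mul Finset.univ
    (r := fun b => (y b - y b * Real.log (y b)) - (x b - x b * Real.log (x b)))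
    (f := fun b => 8 * (x b + y b) * L ^ 2 + 4.4 * Real.exp (-L))
    (g := fun b => (√(y b) - √(x b)) ^ 2)
    (fun b _ => by
      have := (hx b).le; have := (hy b).le; positivity)
    (fun b _ => sq_nonneg _)
    (fun b _ => sq_sub_mul_log_sub_le (hx b) (hy b)
      (le_one_of_sum_eq_one (fun b => (hx b).le) hx1 b)
      (le_one_of_sum_eq_one (fun b => (hy b).le) hy1 b) (by linarith))
  -- The added linear terms disappear because both vectors have total mass one.
  have e1 : ∑ b, ((y b - y b * Real.log (y b)) - (x b - x b * Real.log (x b)))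
      = -(∑ b, y b * Real.log (y b) - ∑ b, x b * Real.log (x b)) := by
    simp only [Finset.sum_sub_distrib]
    rw [hx1, hy1]; ring
  have e2 : ∑ b, (8 * (x b + y b) * L ^ 2 + 4.4 * Real.exp (-L))
      = 16 * L ^ 2 + 4.4 * (Fintype.card B * Real.exp (-L)) := by
    rw [Finset.sum_add_distrib, ← Finset.sum_mul, ← Finset.mul_sum, Finset.sum_add_distrib,
      hx1, hy1]
    simp
    ring
  rw [e1, e2, neg_sq] at key
  refine key.trans (mul_le_mul_of_nonneg_right ?_ hh)
  nlinarith

theorem sum_abs_sub_sq_le {x y : B → ℝ} (hx : ∀ b, 0 ≤ x b) (hy : ∀ b, 0 ≤ y b)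
    (hx1 : ∑ b, x b = 1) (hy1 : ∑ b, y b = 1) :
    (∑ b, |y b - x b|) ^ 2 ≤ 4 * hellingerSq x y := by
  have key := Finset.sum_sq_le_sum_mul_sum_of_sq_le_mul Finset.univ
    (r := fun b => |y b - x b|) (f := fun b => 2 * (x b + y b))
    (g := fun b => (√(y b) - √(x b)) ^ 2)
    (fun b _ => by have := hx b; have := hy b; positivity) (fun b _ => sq_nonneg _)
    (fun b _ => by
      have h1 := Real.sq_sqrt (hx b)
      have h2 := Real.sq_sqrt (hy b)
      have : y b - x b = (√(y b) + √(x b)) * (√(y b) - √(x b)) := by nlinarith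
      rw [sq_abs, this, mul_pow]
      refine mul_le_mul_of_nonneg_right ?_ (sq_nonneg _)
      nlinarith [sq_nonneg (√(y b) - √(x b))])
  rw [← Finset.mul_sum, Finset.sum_add_distrib, hx1, hy1] at key
  norm_num at key
  exact key

theorem hellingerSq_le_two {x y : B → ℝ} (hx : ∀ b, 0 ≤ x b) (hy : ∀ b, 0 ≤ y b)
    (hx1 : ∑ b, x b = 1) (hy1 : ∑ b, y b = 1) : hellingerSq x y ≤ 2 := by
  rw [hellingerSq_eq hx hy hx1 hy1]
  have : 0 ≤ ∑ b, √(y b) * √(x b) := Finset.sum_nonneg fun b _ => by positivity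
  linarith

variable [Nonempty B]

/-- The derivative at a maximizer over a convex set is nonpositive in every feasible direction. This
form also covers the boundary case `lam = 1`. -/
theorem rateObjective_first_order {α : ℝ} {R : B → ℝ} {lam l : ℝ} (hlam : lam ∈ Set.Ioc (0 : ℝ) 1)
    (hl : l ∈ Set.Ioc (0 : ℝ) 1) (hmax : IsMaxOn (rateObjective α R) (Set.Ioc (0 : ℝ) 1) lam) :
    (l - lam) * ((α - 1) / lam + ∑ b, R b * softmax lam R b) ≤ 0 := by
  have hd : HasDerivAt (rateObjective α R)
      ((α - 1) * lam⁻¹ + (∑ b, Real.exp (lam * R b) * R b) / ∑ b, Real.exp (lam * R b)) lam := by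
    unfold rateObjective
    refine ((Real.hasDerivAt_log hlam.1.ne').const_mul (α - 1)).add (HasDerivAt.log ?_
      (sum_exp_pos _).ne')
    refine HasDerivAt.fun_sum fun b _ => ?_
    simpa using ((hasDerivAt_id lam).mul_const (R b)).exp
  have hs : ∑ b, R b * softmax lam R b
      = (∑ b, Real.exp (lam * R b) * R b) / ∑ b, Real.exp (lam * R b) := by
    unfold softmax
    rw [Finset.sum_div]
    exact Finset.sum_congr rfl fun b _ => by ring
  have h := hmax.localize.hasFDerivWithinAt_nonpos hd.hasFDerivAt.hasFDerivWithinAt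
    (y := l - lam) (mem_posTangentConeAt_of_segment_subset (by
      rw [add_sub_cancel]
      exact (convex_Ioc (0 : ℝ) 1).segment_subset hlam hl))
  rw [hs, div_eq_mul_inv (α - 1)]
  simpa using h

theorem growth_scalar_of_le_one {α L h K E r : ℝ} (hL : 0.69 ≤ L)
    (hα : 70 * L ^ 2 + 2 * L + 1 ≤ α - 1) (h0 : 0 ≤ h) (h2 : h ^ 2 ≤ 2) (hK : h ^ 2 ≤ K)
    (hE : |E| ≤ 5.1 * L * h) (hr0 : 0 < r) (hr1 : r ≤ 1) :
    3 / 5 * h ^ 2 + (r - 1) ^ 2 ≤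
      r * K + (α - 1) * (r - 1 - Real.log r) + (1 - r) * E := by
  have hφ := half_sq_le_sub_log hr0 hr1
  obtain ⟨z, rfl⟩ : ∃ z, r = 1 - z := ⟨1 - r, by ring⟩
  have hrK := mul_le_mul_of_nonneg_left hK hr0.le
  have hz0 : 0 ≤ z := by linarith
  rw [sub_sub_cancel] at hφ ⊢
  have hcross : z * -(5.1 * L * h) ≤ z * E := mul_le_mul_of_nonneg_left (abs_le.mp hE).1 hz0
  have h3 : (70 * L ^ 2 + 2 * L + 1) * (z ^ 2 / 2) ≤
      (α - 1) * (1 - z - 1 - Real.log (1 - z)) :=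
    mul_le_mul hα hφ (by positivity) (le_trans (by positivity) hα)
  have h5 : h ≤ 1.415 := by nlinarith
  -- Since `r K` is only `(1 - z) K`, the loss `z h²` is also treated as a cross term of size `L z
  -- h`, using `h ≤ √2` and `L ≥ 0.69`. Together with the `5.1 L z h` from the entropy it fits under
  -- the square `h8`; the `L² z²` in that square is paid for by the `70 L²` in `α`.
  have h6 : z * h * h ≤ z * h * 1.415 := mul_le_mul_of_nonneg_left h5 (by positivity)
  have h7 : 0.69 * (z * h) ≤ L * (z * h) := mul_le_mul_of_nonneg_right hL (by positivity)
  have h8 : 0 ≤ (0.63 * h - 5.7 * (L * z)) ^ 2 := sq_nonneg _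
  have h9 : 0.69 * z ^ 2 ≤ L * z ^ 2 := mul_le_mul_of_nonneg_right hL (sq_nonneg z)
  have h10 : 0 ≤ h ^ 2 := sq_nonneg h
  have h11 : 0 ≤ (L * z) * h := by positivity
  have h12 : 0 ≤ z ^ 2 := sq_nonneg z
  generalize (α - 1) * (1 - z - 1 - Real.log (1 - z)) = φ at *
  have h13 : 0 ≤ L ^ 2 * z ^ 2 := by positivity
  linarith

theorem growth_scalar_of_one_le {α L h K E r : ℝ} (hL : 0.69 ≤ L)
    (hα : 70 * L ^ 2 + 2 * L + 1 ≤ α - 1) (hK : h ^ 2 ≤ K)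
    (hE : |E| ≤ 5.1 * L * h) (hr1 : 1 ≤ r) :
    3 / 5 * h ^ 2 + (r - 1) ^ 2 / r ≤
      r * K + (α - 1) * (r - 1 - Real.log r) + (1 - r) * E := by
  have hφ := half_sq_div_le_sub_log hr1
  have hr0 : 0 < r := by linarith
  have hrK := mul_le_mul_of_nonneg_left hK hr0.le
  have hs0 : 0 < √r := Real.sqrt_pos.mpr hr0
  have hsr : √r ^ 2 = r := Real.sq_sqrt hr0.le
  -- With `q = (r - 1)/√r` the logarithmic term is at least `q²/2` per unit of `α - 1`, and the
  -- cross term is `5.1 (L q)(√r h)`. It is balanced against `r h² = (√r h)²`, so large `r` does no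
  -- harm.
  obtain ⟨q, hq⟩ : ∃ q, q = (r - 1) / √r := ⟨_, rfl⟩
  have hq0 : 0 ≤ q := hq ▸ div_nonneg (by linarith) hs0.le
  have hqs : r - 1 = q * √r := by rw [hq, div_mul_cancel₀ _ hs0.ne']
  have hq2 : (r - 1) ^ 2 / r = q ^ 2 := by rw [hq, div_pow, hsr]
  have hφ' : (r - 1) ^ 2 / (2 * r) = q ^ 2 / 2 := by rw [← hq2]; field_simp
  rw [hφ'] at hφ
  rw [hq2]
  have h3 : (70 * L ^ 2 + 2 * L + 1) * (q ^ 2 / 2) ≤ (α - 1) * (r - 1 - Real.log r) :=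
    mul_le_mul hα hφ (by positivity) (le_trans (by positivity) hα)
  have hcross : (r - 1) * E ≤ (r - 1) * (5.1 * L * h) :=
    mul_le_mul_of_nonneg_left (abs_le.mp hE).2 (by linarith)
  have hc2 : (r - 1) * (5.1 * L * h) = 5.1 * (L * q) * (√r * h) := by rw [hqs]; ring
  have h10 : 1 * h ^ 2 ≤ r * h ^ 2 := mul_le_mul_of_nonneg_right hr1 (sq_nonneg h)
  have h11 : r * h ^ 2 = (√r * h) ^ 2 := by rw [mul_pow, hsr]
  have h8 : 0 ≤ (0.6 * (√r * h) - 4.25 * (L * q)) ^ 2 := sq_nonneg _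
  have h9 : 0.69 * q ^ 2 ≤ L * q ^ 2 := mul_le_mul_of_nonneg_right hL (sq_nonneg q)
  have h12 : 0 ≤ q ^ 2 := sq_nonneg q
  have h13 : 0 ≤ (L * q) ^ 2 := sq_nonneg _
  have h14 : L ^ 2 * q ^ 2 = (L * q) ^ 2 := by ring
  rw [hc2] at hcross
  generalize (α - 1) * (r - 1 - Real.log r) = φ at *
  generalize √r * h = a at *
  generalize L * q = p at *
  have h15 : 0 ≤ a ^ 2 := sq_nonneg a
  linarith

theorem growth_scalar {α L h K E lam l : ℝ} (hL : 0.69 ≤ L) (hα : 70 * L ^ 2 + 2 * L + 1 ≤ α - 1)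
    (h0 : 0 ≤ h) (h2 : h ^ 2 ≤ 2) (hK : h ^ 2 ≤ K) (hE : |E| ≤ 5.1 * L * h)
    (hlam : lam ∈ Set.Ioc (0 : ℝ) 1) (hl : l ∈ Set.Ioc (0 : ℝ) 1) :
    3 / 5 * h ^ 2 + (l - lam) ^ 2 ≤
      l / lam * K + (α - 1) * (l / lam - 1 - Real.log (l / lam)) + (1 - l / lam) * E := by
  obtain ⟨r, hr⟩ : ∃ r, r = l / lam := ⟨_, rfl⟩
  have hr0 : 0 < r := hr ▸ div_pos hl.1 hlam.1
  have hlr : l = r * lam := by rw [hr, div_mul_cancel₀ _ hlam.1.ne']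
  rw [← hr]
  have hl2 : (l - lam) ^ 2 = (r - 1) ^ 2 * lam ^ 2 := by rw [hlr]; ring
  rcases le_total r 1 with hr1 | hr1
  · have h := growth_scalar_of_le_one hL hα h0 h2 hK hE hr0 hr1
    have : (r - 1) ^ 2 * lam ^ 2 ≤ (r - 1) ^ 2 :=
      mul_le_of_le_one_right (sq_nonneg _) (pow_le_one₀ hlam.1.le hlam.2)
    linarith
  · have h := growth_scalar_of_one_le hL hα hK hE hr1
    have : (r - 1) ^ 2 * lam ^ 2 ≤ (r - 1) ^ 2 / r := by
      rw [div_eq_mul_inv]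
      refine mul_le_mul_of_nonneg_left ?_ (sq_nonneg _)
      rw [← one_div, le_div_iff₀ hr0]
      have : lam ^ 2 * r = l * lam := by rw [hlr]; ring
      rw [this]
      exact mul_le_one₀ hl.2 hlam.1.le hlam.2
    linarith

/-- With `r = l / lam`, the gap is exactly `r` times the KL divergence of `y` from the softmax, plus
`(α - 1)(r - 1 - log r)`, plus `1 - r` times the difference of the negative entropies, minus a
first-order term that is nonpositive at a maximizer. `growth_scalar` bounds the first three. No
concavity of `rateObjective` is needed. -/
theorem liftedObjective_growth {α L : ℝ} {R : B → ℝ} {lam l : ℝ} {y : B → ℝ}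
    (hL2 : Real.log 2 ≤ L) (hL : Real.log (Fintype.card B) ≤ L)
    (hα : 70 * L ^ 2 + 2 * L + 1 ≤ α - 1) (hlam : lam ∈ Set.Ioc (0 : ℝ) 1)
    (hl : l ∈ Set.Ioc (0 : ℝ) 1) (hmax : IsMaxOn (rateObjective α R) (Set.Ioc (0 : ℝ) 1) lam)
    (hy : ∀ b, 0 < y b) (hy1 : ∑ b, y b = 1) :
    liftedObjective α R l y + (3 / 5 * hellingerSq (softmax lam R) y + (l - lam) ^ 2)
      ≤ liftedObjective α R lam (softmax lam R) := by
  have hx := softmax_pos lam R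
  have hx1 := sum_softmax lam R
  have hfo := rateObjective_first_order hlam hl hmax
  have hE := abs_entropy_sub_le hx hy hx1 hy1 hL2 hL
  have hK := hellingerSq_le_kl (fun b => (hy b).le) hx hy1 hx1
  have hh := hellingerSq_nonneg (softmax lam R) y
  have hl2 := Real.log_two_gt_d9
  have h2 := hellingerSq_le_two (fun b => (hx b).le) (fun b => (hy b).le) hx1 hy1
  rw [sum_mul_log_softmax lam R hy1] at hK
  rw [← Real.sq_sqrt hh] at h2 hK
  have hg := growth_scalar (by linarith) hα (Real.sqrt_nonneg _) h2 hK hE hlam hl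
  rw [Real.sq_sqrt hh] at hg
  have hEx := sum_mul_log_softmax lam R hx1
  unfold liftedObjective
  obtain ⟨r, hr⟩ : ∃ r, r = l / lam := ⟨_, rfl⟩
  have hlr : l = r * lam := by rw [hr, div_mul_cancel₀ _ hlam.1.ne']
  have hlog : Real.log l = Real.log r + Real.log lam := by
    rw [hr, Real.log_div hl.1.ne' hlam.1.ne']; ring
  rw [← hr] at hg
  have hfo' : (r - 1) * ((α - 1) + lam * ∑ b, R b * softmax lam R b) ≤ 0 := by
    have : (l - lam) * ((α - 1) / lam + ∑ b, R b * softmax lam R b)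
        = (r - 1) * ((α - 1) + lam * ∑ b, R b * softmax lam R b) := by
      have := hlam.1.ne'
      rw [hlr]; field_simp
    rwa [this] at hfo
  rw [hlog]
  rw [hEx] at hg ⊢
  generalize (l - lam) ^ 2 = q at *
  generalize hellingerSq (softmax lam R) y = u at *
  generalize ∑ b, R b * y b = v1 at *
  generalize ∑ b, R b * softmax lam R b = v2 at *
  generalize ∑ b, y b * Real.log (y b) = v3 at *
  generalize Real.log (∑ c, Real.exp (lam * R c)) = v4 at *
  generalize Real.log r = v5 at *
  generalize Real.log lam = v6 at *
  have e : lam * v2 + (α - 1) * v6 - (lam * v2 - v4) - (l * v1 + (α - 1) * (v5 + v6) - v3)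
      = (r * (v3 - (lam * v1 - v4)) + (α - 1) * (r - 1 - v5)
        + (1 - r) * (v3 - (lam * v2 - v4))) - (r - 1) * ((α - 1) + lam * v2) := by
    rw [hlr]; ring
  linarith

end Growth

/-! ### Means over product laws -/

section Mean

variable {N : ℕ} {A : Fin N → Type*} [∀ i, Fintype (A i)]

theorem sum_prodLaw (x : ∀ i, stdSimplex ℝ (A i)) : ∑ a, prodLaw x a = 1 := (prodLaw x).2.2

theorem prodLaw_apply (x : ∀ i, stdSimplex ℝ (A i)) (a : ∀ i, A i) :
    prodLaw x a = ∏ i, x i (a i) := rfl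

theorem sum_law_mul_mem_Icc {B : Type*} [Fintype B] (p : stdSimplex ℝ B) {q : B → ℝ} {lo hi : ℝ}
    (hq : ∀ b, q b ∈ Set.Icc lo hi) : ∑ b, p b * q b ∈ Set.Icc lo hi := by
  have h1 : ∑ b, p b = 1 := p.2.2
  constructor
  · calc lo = ∑ b, p b * lo := by rw [← Finset.sum_mul, h1, one_mul]
      _ ≤ _ := Finset.sum_le_sum fun b _ => mul_le_mul_of_nonneg_left (hq b).1 (p.2.1 b)
  · calc _ ≤ ∑ b, p b * hi :=
          Finset.sum_le_sum fun b _ => mul_le_mul_of_nonneg_left (hq b).2 (p.2.1 b)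
      _ = hi := by rw [← Finset.sum_mul, h1, one_mul]

theorem meanJoint_mem_Icc (x : ∀ i, stdSimplex ℝ (A i)) {q : (∀ i, A i) → ℝ} {lo hi : ℝ}
    (hq : ∀ a, q a ∈ Set.Icc lo hi) : meanJoint q x ∈ Set.Icc lo hi :=
  sum_law_mul_mem_Icc (prodLaw x) hq

theorem meanJoint_sub (x : ∀ i, stdSimplex ℝ (A i)) (q q' : (∀ i, A i) → ℝ) :
    meanJoint q x - meanJoint q' x = meanJoint (fun a => q a - q' a) x := by
  unfold meanJoint
  rw [← Finset.sum_sub_distrib]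
  exact Finset.sum_congr rfl fun a _ => by ring

/-- The `ℓ¹` distance of two mixed actions. -/
noncomputable def lawDist {B : Type*} [Fintype B] (x y : stdSimplex ℝ B) : ℝ := ∑ b, |y b - x b|

theorem lawDist_nonneg {B : Type*} [Fintype B] (x y : stdSimplex ℝ B) : 0 ≤ lawDist x y :=
  Finset.sum_nonneg fun _ _ => abs_nonneg _

theorem lawDist_self {B : Type*} [Fintype B] (x : stdSimplex ℝ B) : lawDist x x = 0 := by
  simp [lawDist]

/-- The difference factors over the players, and every factor except that of player `i` sums to one.
-/
theorem sum_abs_prodLaw_update_sub (x : ∀ i, stdSimplex ℝ (A i)) (i : Fin N)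
    (p p' : stdSimplex ℝ (A i)) :
    ∑ a, |prodLaw (Function.update x i p') a - prodLaw (Function.update x i p) a|
      = lawDist p p' := by
  classical
  have h : ∀ a : ∀ j, A j,
      |prodLaw (Function.update x i p') a - prodLaw (Function.update x i p) a|
        = ∏ j, (Function.update (fun j (b : A j) => x j b) i (fun b => |p' b - p b|)) j (a j) := by
    intro a
    rw [prodLaw_apply, prodLaw_apply, ← Finset.mul_prod_erase _ _ (Finset.mem_univ i),
      ← Finset.mul_prod_erase _ _ (Finset.mem_univ i),
      ← Finset.mul_prod_erase _ (fun j => Function.update (fun j (b : A j) => x j b) i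
        (fun b => |p' b - p b|) j (a j)) (Finset.mem_univ i)]
    simp only [Function.update_self]
    have e : ∀ r : stdSimplex ℝ (A i), ∏ j ∈ Finset.univ.erase i, (Function.update x i r j) (a j)
        = ∏ j ∈ Finset.univ.erase i, x j (a j) := fun r =>
      Finset.prod_congr rfl fun j hj => by rw [Function.update_of_ne (Finset.ne_of_mem_erase hj)]
    have e' : ∏ j ∈ Finset.univ.erase i, Function.update (fun j (b : A j) => x j b) i
        (fun b => |p' b - p b|) j (a j) = ∏ j ∈ Finset.univ.erase i, x j (a j) :=
      Finset.prod_congr rfl fun j hj => by rw [Function.update_of_ne (Finset.ne_of_mem_erase hj)]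
    rw [e, e, e', ← sub_mul, abs_mul,
      abs_of_nonneg (a := ∏ j ∈ Finset.univ.erase i, x j (a j))
        (Finset.prod_nonneg fun j _ => (x j).2.1 (a j))]
  rw [Finset.sum_congr rfl fun a _ => h a, ← Fintype.prod_sum,
    ← Finset.mul_prod_erase _ _ (Finset.mem_univ i)]
  simp only [Function.update_self]
  rw [Finset.prod_eq_one, mul_one]
  · rfl
  · intro j hj
    rw [Function.update_of_ne (Finset.ne_of_mem_erase hj)]
    exact (x j).2.2

theorem sum_abs_prodLaw_sub_le (x y : ∀ i, stdSimplex ℝ (A i)) :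
    ∑ a, |prodLaw y a - prodLaw x a| ≤ ∑ i, lawDist (x i) (y i) := by
  classical
  -- Hybrid argument: the players are switched from `x` to `y` one at a time.
  have key : ∀ s : Finset (Fin N),
      ∑ a, |prodLaw (fun i => if i ∈ s then y i else x i) a - prodLaw x a|
        ≤ ∑ i ∈ s, lawDist (x i) (y i) := by
    intro s
    induction s using Finset.induction_on with
    | empty => simp
    | insert i s hi ih =>
      rw [Finset.sum_insert hi]
      set z : ∀ j, stdSimplex ℝ (A j) := fun j => if j ∈ s then y j else x j with hz
      have h1 : (fun j => if j ∈ insert i s then y j else x j) = Function.update z i (y i) := by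
        funext j
        rcases eq_or_ne j i with rfl | hj
        · simp
        · simp [hj, hz]
      have h2 : z = Function.update z i (x i) := by
        rw [eq_comm, Function.update_eq_self_iff]
        simp [hz, hi]
      rw [h1, ← sum_abs_prodLaw_update_sub z i (x i) (y i), ← h2]
      refine le_trans ?_ (add_le_add_right ih _)
      rw [← Finset.sum_add_distrib]
      exact Finset.sum_le_sum fun a _ => abs_sub_le _ _ _
  simpa using key Finset.univ

theorem abs_meanJoint_sub_le (x y : ∀ i, stdSimplex ℝ (A i)) {q : (∀ i, A i) → ℝ} {c : ℝ}
    (hq : ∀ a, q a ∈ Set.Icc 0 c) :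
    |meanJoint q y - meanJoint q x| ≤ c / 2 * ∑ i, lawDist (x i) (y i) := by
  have hx := sum_prodLaw x
  have hy := sum_prodLaw y
  -- Both laws have mass one, so `q` may be centred at `c / 2`; this halves the constant.
  have e : meanJoint q y - meanJoint q x = ∑ a, (prodLaw y a - prodLaw x a) * (q a - c / 2) := by
    unfold meanJoint
    simp only [sub_mul, mul_sub, Finset.sum_sub_distrib, ← Finset.sum_mul, hx, hy]
    ring
  have hc : ∀ a, |q a - c / 2| ≤ c / 2 := fun a => by
    have := hq a
    rw [abs_le]
    constructor <;> linarith [this.1, this.2]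
  rw [e]
  by_cases hA : Nonempty (∀ i, A i)
  · obtain ⟨a0⟩ := hA
    have hc0 : 0 ≤ c / 2 := (abs_nonneg _).trans (hc a0)
    calc _ ≤ ∑ a, |(prodLaw y a - prodLaw x a) * (q a - c / 2)| := Finset.abs_sum_le_sum_abs _ _
      _ ≤ ∑ a, c / 2 * |prodLaw y a - prodLaw x a| := Finset.sum_le_sum fun a _ => by
          rw [abs_mul, mul_comm]
          exact mul_le_mul_of_nonneg_right (hc a) (abs_nonneg _)
      _ ≤ _ := by
          rw [← Finset.mul_sum]
          exact mul_le_mul_of_nonneg_left (sum_abs_prodLaw_sub_le x y) hc0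
  · rw [not_nonempty_iff] at hA
    simp at hx

theorem sum_lawDist_update_le (x y : ∀ i, stdSimplex ℝ (A i)) (i : Fin N)
    (p : stdSimplex ℝ (A i)) :
    ∑ j, lawDist (Function.update x i p j) (Function.update y i p j)
      ≤ ∑ j, lawDist (x j) (y j) := by
  refine Finset.sum_le_sum fun j _ => ?_
  rcases eq_or_ne j i with rfl | hj
  · rw [Function.update_self, Function.update_self, lawDist_self]
    exact lawDist_nonneg _ _
  · rw [Function.update_of_ne hj, Function.update_of_ne hj]

variable [∀ i, DecidableEq (A i)]

/-- The law of a deterministic action. -/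
def pureLaw {B : Type*} [Fintype B] [DecidableEq B] (b : B) : stdSimplex ℝ B :=
  ⟨Pi.single b 1, single_mem_stdSimplex ℝ b⟩

theorem pureLaw_apply {B : Type*} [Fintype B] [DecidableEq B] (b c : B) :
    pureLaw b c = if c = b then 1 else 0 := Pi.single_apply b (1 : ℝ) c

theorem meanOthers_eq_meanJoint (q : (∀ i, A i) → ℝ) (x : ∀ i, stdSimplex ℝ (A i)) (i : Fin N)
    (b : A i) : meanOthers q x i b = meanJoint q (Function.update x i (pureLaw b)) := by
  unfold meanOthers meanJoint
  refine Finset.sum_congr rfl fun a _ => ?_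
  have e : ∏ j ∈ Finset.univ.erase i, Function.update x i (pureLaw b) j (a j)
      = ∏ j ∈ Finset.univ.erase i, x j (a j) :=
    Finset.prod_congr rfl fun j hj => by rw [Function.update_of_ne (Finset.ne_of_mem_erase hj)]
  rw [prodLaw_apply, ← Finset.mul_prod_erase _ _ (Finset.mem_univ i), Function.update_self,
    pureLaw_apply, e]
  split_ifs <;> simp

theorem sum_mul_meanOthers (q : (∀ i, A i) → ℝ) (x : ∀ i, stdSimplex ℝ (A i)) (i : Fin N) :
    ∑ c, x i c * meanOthers q x i c = meanJoint q x := by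
  unfold meanOthers meanJoint
  simp only [Finset.mul_sum]
  rw [Finset.sum_comm]
  refine Finset.sum_congr rfl fun a _ => ?_
  simp only [mul_ite, mul_zero]
  rw [Finset.sum_ite_eq, if_pos (Finset.mem_univ _), prodLaw_apply,
    ← Finset.mul_prod_erase _ _ (Finset.mem_univ i), mul_assoc]

end Mean

/-! ### The iterates -/

namespace MarkovGame

variable {N H : ℕ} {S : Type*} {A : Fin N → Type*} [Fintype S] [∀ i, Fintype (A i)]

/-- The one-step reward plus continuation value `r_{i,h} + P_h V_{i,h+1}^(t)`. -/
noncomputable def stagePayoff (G : MarkovGame N H S A) (π : PolicySeq H S A) (t : ℕ) (i : Fin N)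
    (h : Fin H) (s : S) (a : ∀ j, A j) : ℝ :=
  G.reward i h s a + ∑ s', G.trans h s a s' * G.vIter π t i h.succ s'

theorem vIter_zero (G : MarkovGame N H S A) (π : PolicySeq H S A) (i : Fin N) (j : Fin (H + 1))
    (s : S) : G.vIter π 0 i j s = 0 := by
  rw [vIter]

theorem vIter_last (G : MarkovGame N H S A) (π : PolicySeq H S A) (t : ℕ) (i : Fin N) (s : S) :
    G.vIter π t i (Fin.last H) s = 0 := by
  cases t with
  | zero => rw [vIter]
  | succ t => rw [vIter]; beta_reduce; rw [Fin.reverseInduction_last]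

theorem vIter_succ_castSucc (G : MarkovGame N H S A) (π : PolicySeq H S A) (t : ℕ) (i : Fin N)
    (h : Fin H) (s : S) :
    G.vIter π (t + 1) i h.castSucc s = (1 - stepSize H (t + 1)) * G.vIter π t i h.castSucc s
      + stepSize H (t + 1) * meanJoint (G.stagePayoff π (t + 1) i h s)
        (fun j => π (t + 1) j h s) := by
  unfold stagePayoff
  conv_lhs => rw [vIter]; beta_reduce; rw [Fin.reverseInduction_castSucc]
  conv_rhs => rw [vIter]

theorem qIter_succ_castSucc (G : MarkovGame N H S A) (π : PolicySeq H S A) (t : ℕ) (i : Fin N)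
    (h : Fin H) (s : S) (a : ∀ j, A j) :
    G.qIter π (t + 1) i h.castSucc s a = (1 - stepSize H (t + 1)) * G.qIter π t i h.castSucc s a
      + stepSize H (t + 1) * (G.reward i h s a + ∑ s', G.trans h s a s' *
        if hh : (h : ℕ) + 1 < H then
          meanJoint (G.qIter π (t + 1) i h.succ s') (fun j => π (t + 1) j ⟨(h : ℕ) + 1, hh⟩ s')
        else 0) := by
  conv_lhs => rw [qIter]; beta_reduce; rw [Fin.reverseInduction_castSucc]
  conv_rhs => rw [qIter]

/-- Reward and transitions do not change with `t`, so averaging `r + P(·)` over rounds equals `r +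
P` of the averages. The induction is forward in `t` and, within a round, backward in `h`. -/
theorem qIter_eq_stagePayoff (G : MarkovGame N H S A) (π : PolicySeq H S A) {t : ℕ} (ht : 1 ≤ t)
    (i : Fin N) (h : Fin H) (s : S) (a : ∀ j, A j) :
    G.qIter π t i h.castSucc s a = G.stagePayoff π t i h s a := by
  induction t generalizing h s a with
  | zero => omega
  | succ t iht =>
    -- In round `0` the identity fails, since `Q^(0) = 0` is not `r + P V^(0)`. The factor `1 - α_1
    -- = 0` removes that round.
    have prev : ∀ (h : Fin H) s a, (1 - stepSize H (t + 1)) * G.qIter π t i h.castSucc s a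
        = (1 - stepSize H (t + 1)) * G.stagePayoff π t i h s a := by
      intro h s a
      rcases Nat.eq_zero_or_pos t with rfl | h0
      · rw [zero_add, stepSize_one, sub_self, zero_mul, zero_mul]
      · rw [iht h0]
    have aux : ∀ n, ∀ h : Fin H, H - (h : ℕ) = n → ∀ s a,
        G.qIter π (t + 1) i h.castSucc s a = G.stagePayoff π (t + 1) i h s a := by
      intro n
      induction n with
      | zero => intro h hn; omega
      | succ n ih =>
        intro h hn s a
        have key : ∀ s', G.vIter π (t + 1) i h.succ s'
            = (1 - stepSize H (t + 1)) * G.vIter π t i h.succ s'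
              + stepSize H (t + 1) * (if hh : (h : ℕ) + 1 < H then
                  meanJoint (G.qIter π (t + 1) i h.succ s')
                    (fun j => π (t + 1) j ⟨(h : ℕ) + 1, hh⟩ s')
                else 0) := by
          intro s'
          split_ifs with hh
          · have e : h.succ = (⟨(h : ℕ) + 1, hh⟩ : Fin H).castSucc := rfl
            rw [e]
            have h1 : G.qIter π (t + 1) i (⟨(h : ℕ) + 1, hh⟩ : Fin H).castSucc s'
                = G.stagePayoff π (t + 1) i ⟨(h : ℕ) + 1, hh⟩ s' := by
              funext a'
              exact ih ⟨(h : ℕ) + 1, hh⟩ (by simp only; omega) s' a'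
            rw [h1, vIter_succ_castSucc]
          · have e : h.succ = Fin.last H := Fin.ext (by simp; omega)
            rw [e, vIter_last, vIter_last]
            ring
        rw [qIter_succ_castSucc, prev, stagePayoff, stagePayoff]
        simp only [key, mul_add, Finset.sum_add_distrib, Finset.mul_sum]
        simp only [mul_left_comm _ (1 - stepSize H (t + 1)),
          mul_left_comm _ (stepSize H (t + 1))]
        ring
    exact aux _ h rfl s a

theorem vIter_mem_Icc (G : MarkovGame N H S A) (π : PolicySeq H S A) (t : ℕ) (i : Fin N)
    (j : Fin (H + 1)) (s : S) : G.vIter π t i j s ∈ Set.Icc (0 : ℝ) ((H : ℝ) - (j : ℕ)) := by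
  induction t generalizing j s with
  | zero =>
    rw [vIter_zero]
    have : ((j : ℕ) : ℝ) ≤ H := by exact_mod_cast Nat.lt_succ_iff.mp j.2
    exact ⟨le_rfl, by linarith⟩
  | succ t iht =>
    induction j using Fin.reverseInduction generalizing s with
    | last => rw [vIter_last]; simp
    | cast h ih =>
      rw [vIter_succ_castSucc]
      have hα0 := stepSize_nonneg H (t + 1)
      have hα1 := stepSize_le_one H (t + 1) (by omega)
      have h1 := iht h.castSucc s
      have h2 : meanJoint (G.stagePayoff π (t + 1) i h s) (fun j => π (t + 1) j h s) ∈
          Set.Icc (0 : ℝ) ((H : ℝ) - (h.castSucc : ℕ)) := by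
        refine meanJoint_mem_Icc _ fun a => ?_
        have h3 := sum_law_mul_mem_Icc (G.trans h s a) (fun s' => ih s')
        have h4 := G.reward_mem i h s a
        unfold stagePayoff
        simp only [Fin.val_succ, Fin.val_castSucc, Set.mem_Icc] at h3 h4 ⊢
        push_cast at h3
        constructor <;> linarith [h3.1, h3.2, h4.1, h4.2]
      have h5 : 0 ≤ 1 - stepSize H (t + 1) := by linarith
      constructor
      · exact add_nonneg (mul_nonneg h5 h1.1) (mul_nonneg hα0 h2.1)
      · have a1 := mul_le_mul_of_nonneg_left h1.2 h5
        have a2 := mul_le_mul_of_nonneg_left h2.2 hα0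
        linarith

theorem stagePayoff_mem_Icc (G : MarkovGame N H S A) (π : PolicySeq H S A) (t : ℕ) (i : Fin N)
    (h : Fin H) (s : S) (a : ∀ j, A j) : G.stagePayoff π t i h s a ∈ Set.Icc (0 : ℝ) H := by
  have h3 := sum_law_mul_mem_Icc (G.trans h s a) (fun s' => G.vIter_mem_Icc π t i h.succ s')
  have h4 := G.reward_mem i h s a
  unfold stagePayoff
  simp only [Fin.val_succ, Set.mem_Icc] at h3 h4 ⊢
  push_cast at h3
  have : (0 : ℝ) ≤ (h : ℕ) := Nat.cast_nonneg _
  constructor <;> linarith [h3.1, h3.2, h4.1, h4.2]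

theorem vIter_sub_mem_Icc (G : MarkovGame N H S A) (π : PolicySeq H S A) (t : ℕ) (i : Fin N)
    (j : Fin (H + 1)) (s : S) : G.vIter π (t + 1) i j s - G.vIter π t i j s ∈
      Set.Icc (-(stepSize H (t + 1) * H)) (stepSize H (t + 1) * H) := by
  have hα0 := stepSize_nonneg H (t + 1)
  have hH : (0 : ℝ) ≤ H := Nat.cast_nonneg H
  induction j using Fin.lastCases with
  | last =>
    rw [vIter_last, vIter_last, sub_self]
    have := mul_nonneg hα0 hH
    exact ⟨by linarith, this⟩
  | cast h =>
    rw [vIter_succ_castSucc]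
    have h1 := G.vIter_mem_Icc π t i h.castSucc s
    have h2 := meanJoint_mem_Icc (fun j => π (t + 1) j h s)
      (fun a => G.stagePayoff_mem_Icc π (t + 1) i h s a)
    set m := meanJoint (G.stagePayoff π (t + 1) i h s) (fun j => π (t + 1) j h s)
    set v := G.vIter π t i h.castSucc s
    have h3 : (1 - stepSize H (t + 1)) * v + stepSize H (t + 1) * m - v
        = stepSize H (t + 1) * (m - v) := by ring
    have h0 : (0 : ℝ) ≤ (h.castSucc : ℕ) := Nat.cast_nonneg _
    rw [h3, ← mul_neg]
    constructor
    · exact mul_le_mul_of_nonneg_left (by linarith [h1.2, h2.1]) hα0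
    · exact mul_le_mul_of_nonneg_left (by linarith [h1.1, h2.2]) hα0

theorem abs_stagePayoff_sub_le (G : MarkovGame N H S A) (π : PolicySeq H S A) (t : ℕ) (i : Fin N)
    (h : Fin H) (s : S) (a : ∀ j, A j) :
    |G.stagePayoff π (t + 1) i h s a - G.stagePayoff π t i h s a| ≤ stepSize H (t + 1) * H := by
  have h3 := sum_law_mul_mem_Icc (G.trans h s a) (fun s' => G.vIter_sub_mem_Icc π t i h.succ s')
  have e : G.stagePayoff π (t + 1) i h s a - G.stagePayoff π t i h s a
      = ∑ s', G.trans h s a s' * (G.vIter π (t + 1) i h.succ s' - G.vIter π t i h.succ s') := by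
    unfold stagePayoff
    simp only [mul_sub, Finset.sum_sub_distrib]
    ring
  rw [e, abs_le]
  exact h3

theorem abs_meanJoint_stagePayoff_sub_le (G : MarkovGame N H S A) (π : PolicySeq H S A) (t : ℕ)
    (i : Fin N) (h : Fin H) (s : S) (x y : ∀ j, stdSimplex ℝ (A j)) :
    |meanJoint (G.stagePayoff π (t + 1) i h s) y - meanJoint (G.stagePayoff π t i h s) x| ≤
      stepSize H (t + 1) * H + H / 2 * ∑ j, lawDist (x j) (y j) := by
  have h1 := abs_meanJoint_sub_le x y (fun a => G.stagePayoff_mem_Icc π t i h s a)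
  have h2 : |meanJoint (G.stagePayoff π (t + 1) i h s) y - meanJoint (G.stagePayoff π t i h s) y| ≤
      stepSize H (t + 1) * H := by
    rw [meanJoint_sub, abs_le]
    exact meanJoint_mem_Icc y fun a => abs_le.mp (G.abs_stagePayoff_sub_le π t i h s a)
  exact (abs_sub_le _ _ _).trans (add_le_add h2 h1)

theorem vIter_congr (G : MarkovGame N H S A) {π π' : PolicySeq H S A} {n : ℕ}
    (hπ : ∀ t, t ≤ n → π t = π' t) {t : ℕ} (ht : t ≤ n) : G.vIter π t = G.vIter π' t := by
  induction t with
  | zero => rw [vIter, vIter]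
  | succ t ih => rw [vIter, vIter, ih (by omega), hπ (t + 1) ht]

variable [∀ i, DecidableEq (A i)]

/-- The regret vectors of the algorithm with `V`-updates without the weight `w_t`. -/
noncomputable def gain (G : MarkovGame N H S A) (π : PolicySeq H S A) (i : Fin N)
    (h : Fin H) (s : S) (t : ℕ) (b : A i) : ℝ :=
  if t = 0 then 0 else
    meanOthers (G.stagePayoff π t i h s) (fun j => π t j h s) i b
      - meanJoint (G.stagePayoff π t i h s) (fun j => π t j h s)

theorem vRegretVec_eq (G : MarkovGame N H S A) (π : PolicySeq H S A) (i : Fin N)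
    (h : Fin H) (s : S) (t : ℕ) (b : A i) :
    G.vRegretVec π i h s t b = utilWeight H t * G.gain π i h s t b := by
  unfold vRegretVec gain
  split_ifs
  · simp
  · congr 2
    exact sum_mul_meanOthers (G.stagePayoff π t i h s) (fun j => π t j h s) i

theorem qRegretVec_eq_vRegretVec (G : MarkovGame N H S A) (π : PolicySeq H S A) (i : Fin N)
    (h : Fin H) (s : S) : G.qRegretVec π i h s = G.vRegretVec π i h s := by
  funext t b
  rw [vRegretVec_eq]
  unfold qRegretVec gain
  split_ifs with h0
  · simp
  · have : G.qIter π t i h.castSucc s = G.stagePayoff π t i h s :=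
      funext fun a => G.qIter_eq_stagePayoff π (by omega) i h s a
    rw [this]

theorem sum_mul_gain (G : MarkovGame N H S A) (π : PolicySeq H S A) (i : Fin N)
    (h : Fin H) (s : S) (t : ℕ) : ∑ b, G.gain π i h s t b * π t i h s b = 0 := by
  unfold gain
  split_ifs with h0
  · simp
  · have h1 : ∑ b, π t i h s b = 1 := (π t i h s).2.2
    have h2 := sum_mul_meanOthers (G.stagePayoff π t i h s) (fun j => π t j h s) i
    simp only [sub_mul, Finset.sum_sub_distrib, ← Finset.mul_sum, h1]
    rw [← h2, mul_one, sub_eq_zero]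
    exact Finset.sum_congr rfl fun b _ => mul_comm _ _

theorem abs_gain_le (G : MarkovGame N H S A) (π : PolicySeq H S A) (i : Fin N)
    (h : Fin H) (s : S) (t : ℕ) (b : A i) : |G.gain π i h s t b| ≤ H := by
  unfold gain
  split_ifs with h0
  · simp
  · rw [meanOthers_eq_meanJoint]
    have h1 := meanJoint_mem_Icc (Function.update (fun j => π t j h s) i (pureLaw b))
      (fun a => G.stagePayoff_mem_Icc π t i h s a)
    have h2 := meanJoint_mem_Icc (fun j => π t j h s)
      (fun a => G.stagePayoff_mem_Icc π t i h s a)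
    rw [abs_le]
    constructor <;> linarith [h1.1, h1.2, h2.1, h2.2]

/-- A gain is a difference of two mean payoffs. Each changes by at most `α_{t+1} H` through the
drift of the values and by `H/2` times the policy variation, so the bound is twice that. -/
theorem abs_gain_sub_le (G : MarkovGame N H S A) (π : PolicySeq H S A) (i : Fin N)
    (h : Fin H) (s : S) {t : ℕ} (ht : 1 ≤ t) (b : A i) :
    |G.gain π i h s (t + 1) b - G.gain π i h s t b| ≤
      H * ∑ j, lawDist (π t j h s) (π (t + 1) j h s) + 2 * stepSize H (t + 1) * H := by
  unfold gain
  rw [if_neg (by omega), if_neg (by omega), meanOthers_eq_meanJoint, meanOthers_eq_meanJoint]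
  have h1 := G.abs_meanJoint_stagePayoff_sub_le π t i h s (fun j => π t j h s)
    (fun j => π (t + 1) j h s)
  have h2 := G.abs_meanJoint_stagePayoff_sub_le π t i h s
    (Function.update (fun j => π t j h s) i (pureLaw b))
    (Function.update (fun j => π (t + 1) j h s) i (pureLaw b))
  have h3 := mul_le_mul_of_nonneg_left (sum_lawDist_update_le (fun j => π t j h s)
    (fun j => π (t + 1) j h s) i (pureLaw b)) (show (0 : ℝ) ≤ (H : ℝ) / 2 by positivity)
  rw [abs_le] at h1 h2 ⊢
  constructor <;> linarith [h1.1, h1.2, h2.1, h2.2]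

/-! ### Existence of runs, and equivalence of the two algorithms -/

theorem isOFTRLRun_iff_isOMWURun [∀ i, Nonempty (A i)] (G : MarkovGame N H S A) (T : ℕ)
    (α η : ℝ) (π : PolicySeq H S A) : G.IsOFTRLRun T α η π ↔ G.IsOMWURun T α η π := by
  unfold IsOFTRLRun IsOMWURun
  refine forall_congr' fun t => forall_congr' fun _ => forall_congr' fun _ => forall_congr' fun i =>
    forall_congr' fun h => forall_congr' fun s => ?_
  rw [qRegretVec_eq_vRegretVec]
  exact exists_liftedSimplex_isMaxOn_iff α _ _

theorem gain_congr (G : MarkovGame N H S A) {π π' : PolicySeq H S A} {n : ℕ}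
    (hπ : ∀ t, t ≤ n → π t = π' t) (i : Fin N) (h : Fin H) (s : S) {t : ℕ} (ht : t ≤ n) :
    G.gain π i h s t = G.gain π' i h s t := by
  funext b
  unfold gain stagePayoff
  rw [G.vIter_congr hπ ht, hπ t ht]

/-- The signal of round `n + 1` uses only rounds up to `n`. This lets a run be built round by round.
-/
theorem optimisticSignal_congr (G : MarkovGame N H S A) {π π' : PolicySeq H S A} {n : ℕ}
    (hπ : ∀ t, t ≤ n → π t = π' t) (η : ℝ) (i : Fin N) (h : Fin H) (s : S) {t : ℕ}
    (ht : t ≤ n + 1) :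
    optimisticSignal H η (G.vRegretVec π i h s) t
      = optimisticSignal H η (G.vRegretVec π' i h s) t := by
  have key : ∀ τ, τ ≤ n → G.vRegretVec π i h s τ = G.vRegretVec π' i h s τ := fun τ hτ => by
    funext b
    rw [vRegretVec_eq, vRegretVec_eq, G.gain_congr hπ i h s hτ]
  funext b
  unfold optimisticSignal
  rw [key (t - 1) (by omega), Finset.sum_congr rfl fun τ hτ => by
    rw [key τ (by have := Finset.mem_Ico.mp hτ; omega)]]

theorem exists_isOMWURun [∀ i, Nonempty (A i)] (G : MarkovGame N H S A) (T : ℕ)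
    {α : ℝ} (hα : 1 < α) (η : ℝ) : ∃ π : PolicySeq H S A, G.IsOMWURun T α η π := by
  induction T with
  | zero =>
    refine ⟨fun _ i _ _ => pureLaw (Classical.arbitrary (A i)), fun t h1 h2 => ?_⟩
    omega
  | succ T ih =>
    obtain ⟨π, hπ⟩ := ih
    choose lam hlam hmax using fun (i : Fin N) (h : Fin H) (s : S) =>
      exists_isMaxOn_rateObjective hα (optimisticSignal H η (G.vRegretVec π i h s) (T + 1))
    set π' : PolicySeq H S A := Function.update π (T + 1) fun i h s =>
      ⟨softmax (lam i h s) (optimisticSignal H η (G.vRegretVec π i h s) (T + 1)),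
        fun b => (softmax_pos _ _ b).le, sum_softmax _ _⟩ with hπ'
    have hagree : ∀ t, t ≤ T → π' t = π t := fun t ht => by
      rw [hπ', Function.update_of_ne (by omega)]
    refine ⟨π', fun t h1 h2 i h s => ?_⟩
    rw [G.optimisticSignal_congr hagree η i h s h2]
    rcases h2.eq_or_lt with rfl | h2
    · refine ⟨lam i h s, hlam i h s, hmax i h s, fun b => ?_⟩
      rw [hπ', Function.update_self]
      rfl
    · rw [hagree t (by omega)]
      exact hπ t h1 (by omega) i h s

end MarkovGame

/-! ### The regret bound of a single player -/

theorem utilWeight_mul_optimisticSignal {B : Type*} (H : ℕ) (η : ℝ) {g : ℕ → B → ℝ} (hg0 : ∀ b, g 0 b = 0)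
    {t : ℕ} (ht : 1 ≤ t) (b : B) :
    utilWeight H t * optimisticSignal H η (fun τ b => utilWeight H τ * g τ b) t b
      = η * (∑ τ ∈ Finset.Ico 1 t, utilWeight H τ * g τ b + utilWeight H t * g (t - 1) b) := by
  have hw := (utilWeight_pos H t ht).ne'
  have e : utilWeight H t / utilWeight H (t - 1) * (utilWeight H (t - 1) * g (t - 1) b)
      = utilWeight H t * g (t - 1) b := by
    rcases ht.eq_or_lt with rfl | h
    -- For `t = 1` the quotient `w_1 / w_0` is a division by zero; it is harmless because `g 0 = 0`.
    · simp [hg0]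
    · have := (utilWeight_pos H (t - 1) (by omega)).ne'
      field_simp
  unfold optimisticSignal
  rw [e]
  field_simp

section Regret

variable {B : Type*} [Fintype B]

theorem abs_sum_mul_le {u v : B → ℝ} {ε : ℝ} (hu : ∀ b, |u b| ≤ ε) :
    |∑ b, u b * v b| ≤ ε * ∑ b, |v b| := by
  rw [Finset.mul_sum]
  refine (Finset.abs_sum_le_sum_abs _ _).trans (Finset.sum_le_sum fun b _ => ?_)
  rw [abs_mul]
  exact mul_le_mul_of_nonneg_right (hu b) (abs_nonneg _)

/-- Young's inequality. Of `3/5 h ≥ 3/20 D²`, the part `D²/16` is kept, and `7/80 D²` pays for `η ε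
D` at the price `20/7 (η ε)²`. The term `δ²` pays for `η ε |δ|` at the price `(η ε)²/4`. -/
theorem step_scalar {h D δ η ε X : ℝ} (hD : D ^ 2 ≤ 4 * h) (hη : 0 ≤ η)
    (hX : |X| ≤ ε * D + ε * |δ|) :
    D ^ 2 / 16 - 4 * η ^ 2 * ε ^ 2 ≤ 3 / 5 * h + δ ^ 2 - η * X := by
  have h1 : η * X ≤ η * (ε * D + ε * |δ|) :=
    mul_le_mul_of_nonneg_left ((le_abs_self X).trans hX) hη
  have h2 : δ ^ 2 = |δ| ^ 2 := (sq_abs δ).symm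
  rw [h2]
  have h3 : 0 ≤ (η * ε - |δ| * 2) ^ 2 := sq_nonneg _
  have h4 : 0 ≤ (7 * D - 40 * (η * ε)) ^ 2 := sq_nonneg _
  have h5 : 0 ≤ (η * ε) ^ 2 := sq_nonneg _
  nlinarith

/-- The regularizer at `l • y`, shifted by `L`. -/
noncomputable def shiftedReg (α L l : ℝ) (y : B → ℝ) : ℝ :=
  -(α - 1) * Real.log l + ∑ b, y b * Real.log (y b) + L

theorem liftedObjective_eq_shiftedReg (α L : ℝ) (R : B → ℝ) (l : ℝ) (y : B → ℝ) :
    liftedObjective α R l y = l * ∑ b, R b * y b - shiftedReg α L l y + L := by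
  unfold liftedObjective shiftedReg
  ring

variable [Nonempty B]

/-- Entropy is at most `log` of the number of actions (Gibbs with zero signal). Nonnegativity is
what allows `w_t` to be replaced by the larger `w_{t+1}` in front of the regularizer. -/
theorem shiftedReg_nonneg {α L l : ℝ} {y : B → ℝ} (hα : 1 ≤ α) (hl : l ∈ Set.Ioc (0 : ℝ) 1)
    (hL : Real.log (Fintype.card B) ≤ L) (hy : ∀ b, 0 ≤ y b) (hy1 : ∑ b, y b = 1) :
    0 ≤ shiftedReg α L l y := by
  have h1 := liftedObjective_le α (fun _ : B => 0) 1 hy hy1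
  have h2 := hellingerSq_nonneg (softmax 1 (fun _ : B => (0 : ℝ))) y
  simp [liftedObjective, rateObjective] at h1
  have h3 : (α - 1) * Real.log l ≤ 0 :=
    mul_nonpos_of_nonneg_of_nonpos (by linarith) (Real.log_nonpos hl.1.le hl.2)
  unfold shiftedReg
  linarith

/-- The regret of a player who follows the softmax steps with dynamic learning rate, against the
comparator `l • e_a`. -/
theorem weighted_regret_le {H T : ℕ} {α L η c : ℝ} {g : ℕ → B → ℝ} {x : ℕ → B → ℝ} {ε : ℕ → ℝ}
    (hη : 0 ≤ η) (hL2 : Real.log 2 ≤ L) (hL : Real.log (Fintype.card B) ≤ L)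
    (hα : 70 * L ^ 2 + 2 * L + 1 ≤ α - 1) (hg0 : ∀ b, g 0 b = 0) (hgc : ∀ t b, |g t b| ≤ c)
    (hgx : ∀ t, ∑ b, g t b * x t b = 0)
    (hε : ∀ t, 1 ≤ t → ∀ b, |g t b - g (t - 1) b| ≤ ε t)
    (hrun : ∀ t, 1 ≤ t → t ≤ T → ∃ lam ∈ Set.Ioc (0 : ℝ) 1,
      IsMaxOn (rateObjective α (optimisticSignal H η (fun τ b => utilWeight H τ * g τ b) t))
        (Set.Ioc (0 : ℝ) 1) lam ∧
      ∀ b, x t b = softmax lam (optimisticSignal H η (fun τ b => utilWeight H τ * g τ b) t) b)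
    {t : ℕ} (ht : 1 ≤ t) (htT : t ≤ T) {l : ℝ} (hl : l ∈ Set.Ioc (0 : ℝ) 1) (a : B) :
    η * (l * ∑ τ ∈ Finset.Ico 1 (t + 1), utilWeight H τ * g τ a)
      + ∑ τ ∈ Finset.Ico 1 t, utilWeight H τ *
        ((∑ b, |x (τ + 1) b - x τ b|) ^ 2 / 16 - 4 * η ^ 2 * ε τ ^ 2)
      ≤ utilWeight H t * (-(α - 1) * Real.log l + L + 3 * c * η) := by
  classical
  have hL0 : 0 ≤ L := le_trans (Real.log_nonneg (by norm_num)) hL2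
  have hα1 : 1 ≤ α := by nlinarith
  choose! lam hlam hmax hx using hrun
  set R := fun t => optimisticSignal H η (fun τ b => utilWeight H τ * g τ b) t with hR
  set U : ℕ → B → ℝ := fun t b => ∑ τ ∈ Finset.Ico 1 t, utilWeight H τ * g τ b with hU
  have hUs : ∀ t, 1 ≤ t → ∀ b, U (t + 1) b = U t b + utilWeight H t * g t b := fun t ht b => by
    simp only [hU]
    rw [Finset.sum_Ico_succ_top ht]
  have hwR : ∀ t, 1 ≤ t → ∀ y : B → ℝ, utilWeight H t * ∑ b, R t b * y b
      = η * (∑ b, U t b * y b + utilWeight H t * ∑ b, g (t - 1) b * y b) := by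
    intro t ht y
    rw [Finset.mul_sum, Finset.mul_sum, ← Finset.sum_add_distrib, Finset.mul_sum]
    refine Finset.sum_congr rfl fun b _ => ?_
    rw [← mul_assoc, utilWeight_mul_optimisticSignal H η hg0 ht b]
    ring
  have hobj : ∀ t, 1 ≤ t → ∀ (l : ℝ) (y : B → ℝ), utilWeight H t * liftedObjective α (R t) l y
      = l * (η * (∑ b, U t b * y b + utilWeight H t * ∑ b, g (t - 1) b * y b))
        - utilWeight H t * shiftedReg α L l y + utilWeight H t * L := by
    intro t ht l y
    rw [liftedObjective_eq_shiftedReg α L, ← hwR t ht y]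
    ring
  have hxe : ∀ t, 1 ≤ t → t ≤ T → x t = softmax (lam t) (R t) := fun t h1 h2 =>
    funext (hx t h1 h2)
  have hx0 : ∀ t, 1 ≤ t → t ≤ T → ∀ b, 0 < x t b := fun t h1 h2 b => by
    rw [hxe t h1 h2]; exact softmax_pos _ _ b
  have hx1 : ∀ t, 1 ≤ t → t ≤ T → ∑ b, x t b = 1 := fun t h1 h2 => by
    rw [hxe t h1 h2]; exact sum_softmax _ _
  -- The potential is minus the weighted objective at the current iterate, without the optimistic
  -- prediction and up to the constant shift by `L`.
  set Z : ℕ → ℝ := fun t => -(lam t * (η * ∑ b, U t b * x t b))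
    + utilWeight H t * shiftedReg α L (lam t) (x t) with hZ
  -- Growth of the round-`t` objective, evaluated at the next iterate. The predictions combine with
  -- the new gain into `X = ⟨g_t - g_{t-1}, lam_{t+1} x_{t+1} - lam_t x_t⟩`, because `⟨g_t, x_t⟩ =
  -- 0`: prediction error times movement, which `step_scalar` absorbs.
  have hstep : ∀ t, 1 ≤ t → t + 1 ≤ T → Z t + utilWeight H t *
      ((∑ b, |x (t + 1) b - x t b|) ^ 2 / 16 - 4 * η ^ 2 * ε t ^ 2) ≤ Z (t + 1) := by
    intro t ht htT
    have hw := utilWeight_pos H t ht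
    have hgrow := liftedObjective_growth hL2 hL hα (hlam t ht (by omega))
      (hlam (t + 1) (by omega) htT) (hmax t ht (by omega)) (hx0 (t + 1) (by omega) htT)
      (hx1 (t + 1) (by omega) htT)
    rw [← hxe t ht (by omega)] at hgrow
    have h1 := mul_le_mul_of_nonneg_left hgrow hw.le
    rw [mul_add, hobj t ht, hobj t ht] at h1
    have hN := shiftedReg_nonneg hα1 (hlam (t + 1) (by omega) htT) hL
      (fun b => (hx0 (t + 1) (by omega) htT b).le) (hx1 (t + 1) (by omega) htT)
    have h2 := mul_le_mul_of_nonneg_right (utilWeight_le_succ H t) hN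
    have hUx : ∑ b, U (t + 1) b * x (t + 1) b
        = ∑ b, U t b * x (t + 1) b + utilWeight H t * ∑ b, g t b * x (t + 1) b := by
      rw [Finset.mul_sum, ← Finset.sum_add_distrib]
      exact Finset.sum_congr rfl fun b _ => by rw [hUs t ht]; ring
    have hX := abs_sum_mul_le (v := fun b => lam (t + 1) * x (t + 1) b - lam t * x t b)
      (hε t ht)
    have hXe : ∑ b, (g t b - g (t - 1) b) * (lam (t + 1) * x (t + 1) b - lam t * x t b)
        = lam (t + 1) * ∑ b, g t b * x (t + 1) b - lam (t + 1) * ∑ b, g (t - 1) b * x (t + 1) b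
          - lam t * ∑ b, g t b * x t b + lam t * ∑ b, g (t - 1) b * x t b := by
      simp only [Finset.mul_sum]
      rw [← Finset.sum_sub_distrib, ← Finset.sum_sub_distrib, ← Finset.sum_add_distrib]
      exact Finset.sum_congr rfl fun b _ => by ring
    have hvar : ∑ b, |lam (t + 1) * x (t + 1) b - lam t * x t b|
        ≤ ∑ b, |x (t + 1) b - x t b| + |lam (t + 1) - lam t| := by
      have hl1 := hlam (t + 1) (by omega) htT
      calc _ ≤ ∑ b, (|x (t + 1) b - x t b| + |lam (t + 1) - lam t| * x t b) := by
            refine Finset.sum_le_sum fun b _ => ?_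
            have e : lam (t + 1) * x (t + 1) b - lam t * x t b
                = lam (t + 1) * (x (t + 1) b - x t b) + (lam (t + 1) - lam t) * x t b := by ring
            rw [e]
            refine (abs_add_le _ _).trans (add_le_add ?_ ?_)
            · rw [abs_mul, abs_of_pos hl1.1]
              exact mul_le_of_le_one_left (abs_nonneg _) hl1.2
            · rw [abs_mul, abs_of_pos (hx0 t ht (by omega) b)]
        _ = _ := by rw [Finset.sum_add_distrib, ← Finset.mul_sum, hx1 t ht (by omega), mul_one]
    have hε0 : 0 ≤ ε t := (abs_nonneg _).trans (hε t ht (Classical.arbitrary B))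
    have hX2 := hX.trans (mul_le_mul_of_nonneg_left hvar hε0)
    rw [mul_add] at hX2
    have hsq := sum_abs_sub_sq_le (fun b => (hx0 t ht (by omega) b).le)
      (fun b => (hx0 (t + 1) (by omega) htT b).le) (hx1 t ht (by omega)) (hx1 (t + 1) (by omega) htT)
    have h3 := mul_le_mul_of_nonneg_left (step_scalar hsq hη hX2) hw.le
    rw [hXe, hgx t] at h3
    simp only [hZ]
    rw [hUx]
    linarith
  have hZ1 : 0 ≤ Z 1 := by
    have h1 : 1 ≤ T := ht.trans htT
    have hN := shiftedReg_nonneg hα1 (hlam 1 le_rfl h1) hL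
      (fun b => (hx0 1 le_rfl h1 b).le) (hx1 1 le_rfl h1)
    have := mul_nonneg (utilWeight_pos H 1 le_rfl).le hN
    simpa [hZ, hU] using this
  have hZt : ∀ t, 1 ≤ t → t ≤ T → ∑ τ ∈ Finset.Ico 1 t, utilWeight H τ *
        ((∑ b, |x (τ + 1) b - x τ b|) ^ 2 / 16 - 4 * η ^ 2 * ε τ ^ 2) ≤ Z t := by
    intro t ht
    induction t, ht using Nat.le_induction with
    | base => intro _; simpa using hZ1
    | succ t ht ih =>
      intro h
      rw [Finset.sum_Ico_succ_top ht]
      linarith [ih (by omega), hstep t ht h]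
  have hw := utilWeight_pos H t ht
  -- Optimality in the last round against the comparator `l • e_a`. A vertex has zero entropy, so
  -- its regularizer is only `-(α - 1) log l + L`.
  have hfin : liftedObjective α (R t) l (Pi.single a 1) ≤ liftedObjective α (R t) (lam t) (x t) := by
    have h1 := liftedObjective_le α (R t) l (x := Pi.single a 1)
      (single_mem_stdSimplex ℝ a).1 (single_mem_stdSimplex ℝ a).2
    have h2 : rateObjective α (R t) l ≤ rateObjective α (R t) (lam t) := hmax t ht htT hl
    rw [hxe t ht htT, liftedObjective_softmax]
    linarith [hellingerSq_nonneg (softmax l (R t)) (Pi.single a 1)]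
  have h1 := mul_le_mul_of_nonneg_left hfin hw.le
  rw [hobj t ht, hobj t ht] at h1
  have hs : shiftedReg α L l (Pi.single a (1 : ℝ)) = -(α - 1) * Real.log l + L := by
    unfold shiftedReg
    rw [Finset.sum_eq_zero, add_zero]
    intro b _
    by_cases hb : b = a <;> simp [hb]
  have hsum : ∀ f : B → ℝ, ∑ b, f b * (Pi.single a (1 : ℝ) : B → ℝ) b = f a := fun f => by
    simp [Pi.single_apply]
  rw [hs, hsum, hsum] at h1
  have h2 := hZt t ht htT
  have h3 : |∑ b, g (t - 1) b * x t b| ≤ c := by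
    refine (abs_sum_mul_le (hgc (t - 1))).trans ?_
    rw [Finset.sum_congr rfl fun b _ => abs_of_pos (hx0 t ht htT b), hx1 t ht htT, mul_one]
  have h4 := hUs t ht a
  have hc0 : 0 ≤ c := (abs_nonneg _).trans h3
  have h5 : lam t * ∑ b, g (t - 1) b * x t b ≤ c := by
    have hl1 := hlam t ht htT
    calc _ ≤ lam t * c := mul_le_mul_of_nonneg_left ((le_abs_self _).trans h3) hl1.1.le
      _ ≤ c := mul_le_of_le_one_left hc0 hl1.2
  have h6 : l * (g t a - g (t - 1) a) ≤ 2 * c := by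
    have e1 := abs_le.mp (hgc t a)
    have e2 := abs_le.mp (hgc (t - 1) a)
    calc _ ≤ l * (2 * c) := mul_le_mul_of_nonneg_left (by linarith [e1.2, e2.1]) hl.1.le
      _ ≤ 2 * c := mul_le_of_le_one_left (by linarith) hl.2
  have h7 : utilWeight H t * η * (l * (g t a - g (t - 1) a) + lam t * ∑ b, g (t - 1) b * x t b)
      ≤ utilWeight H t * η * (3 * c) :=
    mul_le_mul_of_nonneg_left (by linarith) (by positivity)
  have h8 : η * (l * ∑ τ ∈ Finset.Ico 1 (t + 1), utilWeight H τ * g τ a)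
      = l * (η * U t a) + l * (η * (utilWeight H t * g t a)) := by
    have : ∑ τ ∈ Finset.Ico 1 (t + 1), utilWeight H τ * g τ a = U (t + 1) a := rfl
    rw [this, h4]; ring
  rw [h8]
  simp only [hZ] at h2
  linarith

end Regret

/-! ### The regret of all players -/

theorem card_le_maxActions {N : ℕ} (A : Fin N → Type*) [∀ i, Fintype (A i)] (i : Fin N) :
    Fintype.card (A i) ≤ maxActions A :=
  Finset.le_sup (f := fun i => Fintype.card (A i)) (Finset.mem_univ i)

theorem log_card_le_log_maxActions {N : ℕ} (A : Fin N → Type*) [∀ i, Fintype (A i)]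
    [∀ i, Nonempty (A i)] (i : Fin N) :
    Real.log (Fintype.card (A i)) ≤ Real.log (maxActions A) :=
  Real.log_le_log (by exact_mod_cast Fintype.card_pos)
    (by exact_mod_cast card_le_maxActions A i)

/-- The prediction error in round `τ` involves the movement from `τ - 1` to `τ`, while path length
weights that movement by `w_{τ-1}`. The shift costs the ratio of consecutive weights, at most `2H`.
-/
theorem sum_utilWeight_mul_shift_le {H : ℕ} (hH : 1 ≤ H) {P p : ℕ → ℝ} (hP1 : P 1 = 0)
    (hp : ∀ t, 1 ≤ t → P (t + 1) = p t) {t : ℕ} (ht : 1 ≤ t) :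
    ∑ τ ∈ Finset.Ico 1 t, utilWeight H τ * P τ ^ 2
      ≤ 2 * H * ∑ τ ∈ Finset.Ico 1 t, utilWeight H τ * p τ ^ 2 := by
  have key : ∑ τ ∈ Finset.Ico 1 (t + 1), utilWeight H τ * P τ ^ 2
      ≤ 2 * H * ∑ τ ∈ Finset.Ico 1 t, utilWeight H τ * p τ ^ 2 := by
    induction t, ht using Nat.le_induction with
    | base => simp [hP1]
    | succ t ht ih =>
      rw [Finset.sum_Ico_succ_top (show 1 ≤ t + 1 by omega),
        Finset.sum_Ico_succ_top (f := fun τ => utilWeight H τ * p τ ^ 2) ht, mul_add, hp t ht]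
      refine add_le_add ih ?_
      rw [← mul_assoc]
      exact mul_le_mul_of_nonneg_right (utilWeight_succ_le H t hH ht) (sq_nonneg _)
  rw [Finset.sum_Ico_succ_top ht] at key
  have := mul_nonneg (utilWeight_pos H t ht).le (sq_nonneg (P t))
  linarith

namespace MarkovGame

variable {N H : ℕ} {S : Type*} {A : Fin N → Type*} [∀ i, Fintype (A i)]

/-- The total `ℓ¹` variation of the policies from round `t - 1` to round `t`. -/
noncomputable def policyVariation (π : PolicySeq H S A) (h : Fin H) (s : S) (t : ℕ) : ℝ :=
  if t ≤ 1 then 0 else ∑ j, lawDist (π (t - 1) j h s) (π t j h s)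

/-- The weighted squared path length of the policies of player `j` up to round `t`. -/
noncomputable def pathLength (π : PolicySeq H S A) (h : Fin H) (s : S) (t : ℕ) (j : Fin N) : ℝ :=
  ∑ τ ∈ Finset.Ico 1 t, utilWeight H τ * lawDist (π τ j h s) (π (τ + 1) j h s) ^ 2

theorem sum_utilWeight_mul_variation_sq_le (hH : 1 ≤ H) (π : PolicySeq H S A) (h : Fin H) (s : S)
    {t : ℕ} (ht : 1 ≤ t) :
    ∑ τ ∈ Finset.Ico 1 t, utilWeight H τ *
        (H * policyVariation π h s τ + 2 * stepSize H τ * H) ^ 2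
      ≤ 4 * (H : ℝ) ^ 3 * N * ∑ j, pathLength π h s t j + 32 * (H : ℝ) ^ 3 * utilWeight H t := by
  have h1 : ∑ τ ∈ Finset.Ico 1 t, utilWeight H τ * policyVariation π h s τ ^ 2
      ≤ 2 * H * (N * ∑ j, pathLength π h s t j) := by
    refine (sum_utilWeight_mul_shift_le hH (P := policyVariation π h s)
      (p := fun τ => ∑ j, lawDist (π τ j h s) (π (τ + 1) j h s)) (by simp [policyVariation])
      (fun τ hτ => by rw [policyVariation, if_neg (by omega), Nat.add_sub_cancel]) ht).trans ?_
    refine mul_le_mul_of_nonneg_left ?_ (by positivity)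
    unfold pathLength
    rw [Finset.sum_comm, Finset.mul_sum]
    refine Finset.sum_le_sum fun τ hτ => ?_
    rw [← Finset.mul_sum, mul_left_comm]
    refine mul_le_mul_of_nonneg_left ?_ (utilWeight_pos H τ (Finset.mem_Ico.mp hτ).1).le
    simpa using sq_sum_le_card_mul_sum_sq (s := Finset.univ)
      (f := fun j => lawDist (π τ j h s) (π (τ + 1) j h s))
  have h2 : ∑ τ ∈ Finset.Ico 1 t, utilWeight H τ * stepSize H τ ^ 2
      ≤ utilWeight H t * (4 * H) := by
    refine le_trans ?_ (mul_le_mul_of_nonneg_left (sum_stepSize_sq_le H t hH)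
      (utilWeight_pos H t ht).le)
    rw [Finset.mul_sum]
    exact Finset.sum_le_sum fun τ hτ => mul_le_mul_of_nonneg_right
      (utilWeight_mono H (Finset.mem_Ico.mp hτ).2.le) (sq_nonneg _)
  have h3 : ∑ τ ∈ Finset.Ico 1 t, utilWeight H τ *
        (H * policyVariation π h s τ + 2 * stepSize H τ * H) ^ 2
      ≤ 2 * (H : ℝ) ^ 2 * ∑ τ ∈ Finset.Ico 1 t, utilWeight H τ * policyVariation π h s τ ^ 2
        + 8 * (H : ℝ) ^ 2 * ∑ τ ∈ Finset.Ico 1 t, utilWeight H τ * stepSize H τ ^ 2 := by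
    rw [Finset.mul_sum, Finset.mul_sum, ← Finset.sum_add_distrib]
    refine Finset.sum_le_sum fun τ hτ => ?_
    have hw := (utilWeight_pos H τ (Finset.mem_Ico.mp hτ).1).le
    have : (H * policyVariation π h s τ + 2 * stepSize H τ * H) ^ 2
        ≤ 2 * (H : ℝ) ^ 2 * policyVariation π h s τ ^ 2 + 8 * (H : ℝ) ^ 2 * stepSize H τ ^ 2 := by
      nlinarith [sq_nonneg (H * policyVariation π h s τ - 2 * stepSize H τ * H)]
    have := mul_le_mul_of_nonneg_left this hw
    linarith
  have h4 := mul_le_mul_of_nonneg_left h1 (show 0 ≤ 2 * (H : ℝ) ^ 2 by positivity)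
  have h5 := mul_le_mul_of_nonneg_left h2 (show 0 ≤ 8 * (H : ℝ) ^ 2 by positivity)
  nlinarith

variable [Fintype S] [∀ i, DecidableEq (A i)]

theorem gain_eq_zero_of_subsingleton (G : MarkovGame N H S A) (π : PolicySeq H S A) (i : Fin N)
    [Subsingleton (A i)] (h : Fin H) (s : S) (t : ℕ) (b : A i) : G.gain π i h s t b = 0 := by
  have h1 := G.sum_mul_gain π i h s t
  have h2 : ∑ b, π t i h s b = 1 := (π t i h s).2.2
  rw [Fintype.sum_subsingleton _ b] at h1 h2
  rwa [h2, mul_one] at h1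

variable [∀ i, Nonempty (A i)]

theorem weighted_gain_le_of_isOMWURun (G : MarkovGame N H S A) (hH : 1 ≤ H)
    {T : ℕ} {α L η : ℝ} {π : PolicySeq H S A} (hη : 0 ≤ η) (hηN : η ^ 2 * H ^ 3 * N ^ 2 = 1 / 576)
    (hηH : η * H ≤ 1 / 24) (hL2 : Real.log 2 ≤ L)
    (hL : ∀ i, Real.log (Fintype.card (A i)) ≤ L) (hα : 70 * L ^ 2 + 2 * L + 1 ≤ α - 1)
    (hπ : G.IsOMWURun T α η π) (h : Fin H) (s : S) {t : ℕ} (ht : 1 ≤ t) (htT : t ≤ T) (i : Fin N)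
    {l : ℝ} (hl : l ∈ Set.Ioc (0 : ℝ) 1) (a : A i) :
    η * (l * ∑ τ ∈ Finset.Ico 1 (t + 1), utilWeight H τ * G.gain π i h s τ a)
      ≤ utilWeight H t * (-(α - 1) * Real.log l + L + 25 / 72)
        + 1 / (36 * N) * ∑ j, pathLength π h s t j - pathLength π h s t i / 16 := by
  have hN : 0 < N := i.pos
  have hN' : (1 : ℝ) ≤ N := by exact_mod_cast hN
  have hu : G.vRegretVec π i h s = fun τ b => utilWeight H τ * G.gain π i h s τ b := by
    funext τ b; exact G.vRegretVec_eq π i h s τ b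
  have hrun : ∀ t, 1 ≤ t → t ≤ T → ∃ lam ∈ Set.Ioc (0 : ℝ) 1,
      IsMaxOn (rateObjective α (optimisticSignal H η
        (fun τ b => utilWeight H τ * G.gain π i h s τ b) t)) (Set.Ioc (0 : ℝ) 1) lam ∧
      ∀ b, π t i h s b = softmax lam (optimisticSignal H η
        (fun τ b => utilWeight H τ * G.gain π i h s τ b) t) b := fun t h1 h2 => by
    rw [← hu]; exact hπ t h1 h2 i h s
  have hε : ∀ τ, 1 ≤ τ → ∀ b, |G.gain π i h s τ b - G.gain π i h s (τ - 1) b|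
      ≤ H * policyVariation π h s τ + 2 * stepSize H τ * H := by
    intro τ hτ b
    unfold policyVariation
    split_ifs with h1
    -- In round `1` the previous gain is zero and the variation is set to zero; the drift term `2
    -- α_1 H = 2H` already dominates the gain.
    · obtain rfl : τ = 1 := by omega
      have h0 : G.gain π i h s 0 b = 0 := by simp [gain]
      rw [stepSize_one, Nat.sub_self, h0, sub_zero]
      have := G.abs_gain_le π i h s 1 b
      have : (0 : ℝ) ≤ H := Nat.cast_nonneg H
      linarith
    · obtain ⟨k, rfl⟩ : ∃ k, τ = k + 1 := ⟨τ - 1, by omega⟩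
      exact G.abs_gain_sub_le π i h s (by omega) b
  have key := weighted_regret_le (x := fun t b => π t i h s b) hη hL2 (hL i) hα
    (fun b => by simp [gain]) (G.abs_gain_le π i h s) (G.sum_mul_gain π i h s) hε hrun ht htT hl a
  have hvar := sum_utilWeight_mul_variation_sq_le hH π h s ht
  have hw := (utilWeight_pos H t ht).le
  have e : ∑ τ ∈ Finset.Ico 1 t, utilWeight H τ *
        ((∑ b, |π (τ + 1) i h s b - π τ i h s b|) ^ 2 / 16 - 4 * η ^ 2 *
          (H * policyVariation π h s τ + 2 * stepSize H τ * H) ^ 2)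
      = pathLength π h s t i / 16 - 4 * η ^ 2 * ∑ τ ∈ Finset.Ico 1 t, utilWeight H τ *
        (H * policyVariation π h s τ + 2 * stepSize H τ * H) ^ 2 := by
    unfold pathLength lawDist
    rw [Finset.mul_sum, Finset.sum_div, ← Finset.sum_sub_distrib]
    exact Finset.sum_congr rfl fun τ _ => by ring
  rw [e] at key
  have h1 := mul_le_mul_of_nonneg_left hvar (show 0 ≤ 4 * η ^ 2 by positivity)
  -- From `η² H³ N² = 1/576`: `16/576 = 1/36` and `128/576 = 2/9`.
  have h2 : 4 * η ^ 2 * (4 * (H : ℝ) ^ 3 * N * ∑ j, pathLength π h s t j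
      + 32 * (H : ℝ) ^ 3 * utilWeight H t)
      = 1 / (36 * N) * ∑ j, pathLength π h s t j + 2 / 9 / N ^ 2 * utilWeight H t := by
    have hN0 : (N : ℝ) ≠ 0 := by positivity
    have e3 : η ^ 2 * (H : ℝ) ^ 3 = 1 / (576 * N ^ 2) := by
      rw [← mul_one_div_cancel (a := (N : ℝ) ^ 2) (by positivity)] at hηN
      field_simp at hηN ⊢
      linarith
    calc _ = η ^ 2 * (H : ℝ) ^ 3 * (16 * N * ∑ j, pathLength π h s t j
          + 128 * utilWeight H t) := by ring
      _ = _ := by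
        rw [e3]
        field_simp
        ring
  have h3 : 2 / 9 / (N : ℝ) ^ 2 ≤ 2 / 9 :=
    div_le_self (by norm_num) (one_le_pow₀ hN')
  have h4 := mul_le_mul_of_nonneg_right h3 hw
  -- The constant `25/72` is `2/9 + 3/24`; the second summand is the term `3 c η` with `c = H`.
  have h5 := mul_le_mul_of_nonneg_left hηH hw
  rw [h2] at h1
  nlinarith

theorem sum_weighted_gain_le_of_isOMWURun (G : MarkovGame N H S A) (hH : 1 ≤ H)
    {T : ℕ} {α L η : ℝ} {π : PolicySeq H S A} (hη : 0 ≤ η) (hηN : η ^ 2 * H ^ 3 * N ^ 2 = 1 / 576)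
    (hηH : η * H ≤ 1 / 24) (hL2 : Real.log 2 ≤ L)
    (hL : ∀ i, Real.log (Fintype.card (A i)) ≤ L) (hα : 70 * L ^ 2 + 2 * L + 1 ≤ α - 1)
    (hπ : G.IsOMWURun T α η π) (h : Fin H) (s : S) {t : ℕ} (ht : 1 ≤ t) (htT : t ≤ T) (i : Fin N)
    (a : A i) :
    η * ∑ τ ∈ Finset.Ico 1 (t + 1), utilWeight H τ * G.gain π i h s τ a
      ≤ utilWeight H t * (α * Real.log t + 2 * L + 2) := by
  have hN : 0 < N := i.pos
  have hN' : (0 : ℝ) < N := by exact_mod_cast hN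
  have ht' : (1 : ℝ) ≤ t := by exact_mod_cast ht
  have hw := (utilWeight_pos H t ht).le
  have hL0 : 0 ≤ L := le_trans (Real.log_nonneg (by norm_num)) hL2
  have hlog : 0 ≤ Real.log t := Real.log_nonneg ht'
  obtain ⟨Q, hQ⟩ : ∃ Q, Q = ∑ j, pathLength π h s t j := ⟨_, rfl⟩
  -- The comparator mass `1/t` shrinks the worst possible negative regret, of size `H t w_t`, to `H
  -- w_t`, and costs `(α - 1) log t`. This yields path-length bounds without any sign information on
  -- the regrets; `28/72` is `25/72 + 1/24`.
  have hlt : (1 / (t : ℝ)) ∈ Set.Ioc (0 : ℝ) 1 :=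
    ⟨by positivity, by rw [div_le_one (by positivity)]; exact ht'⟩
  have hsmall : ∀ j : Fin N, pathLength π h s t j / 16 ≤
      utilWeight H t * ((α - 1) * Real.log t + L + 28 / 72) + 1 / (36 * N) * Q := by
    intro j
    have b : A j := Classical.arbitrary (A j)
    have h1 := G.weighted_gain_le_of_isOMWURun hH hη hηN hηH hL2 hL hα hπ h s ht htT j hlt b
    have h2 : -(H * (t * utilWeight H t)) ≤
        ∑ τ ∈ Finset.Ico 1 (t + 1), utilWeight H τ * G.gain π j h s τ b := by
      have h3 := mul_le_mul_of_nonneg_left (sum_utilWeight_le H t) (Nat.cast_nonneg (α := ℝ) H)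
      refine (neg_le_neg h3).trans ?_
      rw [Finset.mul_sum, ← Finset.sum_neg_distrib]
      refine Finset.sum_le_sum fun τ hτ => ?_
      have h4 := (abs_le.mp (G.abs_gain_le π j h s τ b)).1
      have h5 := mul_le_mul_of_nonneg_left h4
        (utilWeight_pos H τ (Finset.mem_Ico.mp hτ).1).le
      linarith
    have h3 := mul_le_mul_of_nonneg_left (mul_le_mul_of_nonneg_left h2 hlt.1.le) hη
    have h4 : η * (1 / (t : ℝ) * -(H * (t * utilWeight H t))) = -(utilWeight H t * (η * H)) := by
      have : (t : ℝ) ≠ 0 := by positivity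
      field_simp
    rw [h4] at h3
    have h5 := mul_le_mul_of_nonneg_left hηH hw
    rw [one_div (t : ℝ), Real.log_inv, ← hQ] at h1
    rw [one_div (t : ℝ)] at h3
    linarith
  have hsum : Q / 16 ≤
      N * (utilWeight H t * ((α - 1) * Real.log t + L + 28 / 72)) + Q / 36 := by
    have h1 := Finset.sum_le_sum fun j (_ : j ∈ Finset.univ) => hsmall j
    rw [← Finset.sum_div, ← hQ] at h1
    simp only [Finset.sum_const, Finset.card_univ, Fintype.card_fin, nsmul_eq_mul] at h1
    have h2 : (N : ℝ) * (1 / (36 * N) * Q) = Q / 36 := by field_simp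
    rw [mul_add, h2] at h1
    exact h1
  -- Since `1/16 - 1/36 = 5/144`, `Q / 36` is at most `144 / (5 · 36) = 4/5` of the total over the
  -- players.
  have hQ2 : 1 / (36 * N) * Q ≤
      4 / 5 * (utilWeight H t * ((α - 1) * Real.log t + L + 28 / 72)) := by
    rw [one_div, inv_mul_le_iff₀ (by positivity)]
    linarith
  have hfin := G.weighted_gain_le_of_isOMWURun hH hη hηN hηH hL2 hL hα hπ h s ht htT i
    (l := 1) ⟨one_pos, le_rfl⟩ a
  rw [← hQ, one_mul, Real.log_one, mul_zero, zero_add] at hfin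
  have hp : 0 ≤ pathLength π h s t i := Finset.sum_nonneg fun τ hτ =>
    mul_nonneg (utilWeight_pos H τ (Finset.mem_Ico.mp hτ).1).le (sq_nonneg _)
  have hα1 : 1 ≤ α := by nlinarith
  have h6 : L + 25 / 72 + 4 / 5 * ((α - 1) * Real.log t + L + 28 / 72)
      ≤ α * Real.log t + 2 * L + 2 := by nlinarith [mul_nonneg (by linarith : 0 ≤ α - 1) hlog]
  have h7 := mul_le_mul_of_nonneg_left h6 hw
  linarith

/-- The averaged regret of every player, at every step, in every state. -/
theorem sum_avgWeight_mul_gain_le (G : MarkovGame N H S A) (hH : 1 ≤ H) {T : ℕ} {β α η : ℝ}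
    {π : PolicySeq H S A} (hβ : 70 ≤ β)
    (hα : α = β * Real.log (maxActions A) ^ 2 + 2 * Real.log (maxActions A) + 2)
    (hη : 0 < η) (hηN : η ^ 2 * H ^ 3 * N ^ 2 = 1 / 576) (hηH : η * H ≤ 1 / 24)
    (hπ : G.IsOMWURun T α η π) (h : Fin H) (s : S) {t : ℕ} (ht : 1 ≤ t) (htT : t ≤ T) (i : Fin N)
    (a : A i) :
    ∑ j ∈ Finset.range t, avgWeight H t (j + 1) * G.gain π i h s (j + 1) a
      ≤ 2 * H / η * (α * Real.log T + 2 * Real.log (maxActions A) + 2) / t := by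
  set L := Real.log (maxActions A) with hLdef
  have hcard : 1 ≤ maxActions A := Fintype.card_pos.trans_le (card_le_maxActions A i)
  have hL0 : 0 ≤ L := Real.log_nonneg (by exact_mod_cast hcard)
  have ht' : (1 : ℝ) ≤ t := by exact_mod_cast ht
  have hw := utilWeight_pos H t ht
  have hα0 : 0 ≤ α := by rw [hα]; positivity
  have hlogt : Real.log t ≤ Real.log T :=
    Real.log_le_log (by positivity) (by exact_mod_cast htT)
  have hlog0 : 0 ≤ Real.log t := Real.log_nonneg ht'
  have hreg : η * ∑ τ ∈ Finset.Ico 1 (t + 1), utilWeight H τ * G.gain π i h s τ a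
      ≤ utilWeight H t * (α * Real.log t + 2 * L + 2) := by
    -- If every player has a single action then `L = 0`, and the growth estimate, which needs `L ≥
    -- log 2`, is unavailable; but then all gains vanish.
    rcases hcard.eq_or_lt with h1 | h1
    · have : Subsingleton (A i) :=
        Fintype.card_le_one_iff_subsingleton.mp (h1 ▸ card_le_maxActions A i)
      simp only [G.gain_eq_zero_of_subsingleton, mul_zero, Finset.sum_const_zero]
      positivity
    · have hL2 : Real.log 2 ≤ L := Real.log_le_log (by norm_num) (by exact_mod_cast h1)
      refine G.sum_weighted_gain_le_of_isOMWURun hH hη.le hηN hηH hL2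
        (log_card_le_log_maxActions A) ?_ hπ h s ht htT i a
      rw [hα]
      nlinarith [sq_nonneg L]
  have e : ∑ j ∈ Finset.range t, avgWeight H t (j + 1) * G.gain π i h s (j + 1) a
      = avgWeight H t 1 * ∑ τ ∈ Finset.Ico 1 (t + 1), utilWeight H τ * G.gain π i h s τ a := by
    rw [Finset.sum_Ico_eq_sum_range, Finset.mul_sum, Nat.add_sub_cancel]
    refine Finset.sum_congr rfl fun j hj => ?_
    rw [avgWeight_eq_mul_utilWeight H t (j + 1) (by omega)
      (by have := Finset.mem_range.mp hj; omega), add_comm 1 j]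
    ring
  have h1 : ∑ τ ∈ Finset.Ico 1 (t + 1), utilWeight H τ * G.gain π i h s τ a
      ≤ utilWeight H t * (α * Real.log T + 2 * L + 2) / η := by
    rw [le_div_iff₀ hη, mul_comm]
    refine hreg.trans (mul_le_mul_of_nonneg_left ?_ hw.le)
    linarith [mul_le_mul_of_nonneg_left hlogt hα0]
  have hC : 0 ≤ α * Real.log T + 2 * L + 2 := by
    have := mul_nonneg hα0 (hlog0.trans hlogt)
    linarith
  rw [e]
  calc _ ≤ avgWeight H t 1 * (utilWeight H t * (α * Real.log T + 2 * L + 2) / η) :=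
        mul_le_mul_of_nonneg_left h1 (avgWeight_nonneg _ _ _)
    _ = (avgWeight H t 1 * utilWeight H t) * ((α * Real.log T + 2 * L + 2) / η) := by ring
    _ ≤ 2 * H / t * ((α * Real.log T + 2 * L + 2) / η) :=
        mul_le_mul_of_nonneg_right (avgWeight_one_le H t hH ht) (by positivity)
    _ = _ := by ring

end MarkovGame

/-! ### The value of the roll-out policy and of its deviations -/

theorem sum_fin_avgWeight_mul (H T t : ℕ) (htT : t ≤ T) (f : ℕ → ℝ) :
    ∑ j : Fin T, avgWeight H t ((j : ℕ) + 1) * f ((j : ℕ) + 1)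
      = ∑ j ∈ Finset.range t, avgWeight H t (j + 1) * f (j + 1) := by
  rw [Fin.sum_univ_eq_sum_range (fun j => avgWeight H t (j + 1) * f (j + 1)) T]
  symm
  refine Finset.sum_subset (fun j hj => ?_) (fun j _ hj => ?_)
  · rw [Finset.mem_range] at hj ⊢; omega
  · rw [Finset.mem_range] at hj
    unfold avgWeight
    rw [if_neg (by omega), zero_mul]

theorem one_add_inv_pow_le_three {H : ℕ} (hH : 1 ≤ H) : (1 + 1 / (H : ℝ)) ^ H ≤ 3 := by
  have hH' : (0 : ℝ) < H := by exact_mod_cast hH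
  have h1 : 1 + 1 / (H : ℝ) ≤ Real.exp (1 / H) := by
    have := Real.add_one_le_exp (1 / (H : ℝ)); linarith
  calc _ ≤ Real.exp (1 / H) ^ H := pow_le_pow_left₀ (by positivity) h1 H
    _ = Real.exp 1 := by rw [← Real.exp_nat_mul, mul_one_div_cancel hH'.ne']
    _ ≤ 3 := by linarith [Real.exp_one_lt_d9]

/-- The seed whose entries from step `m` on are those of `ω`. -/
def tailSeed {H T n m : ℕ} (hT : 1 ≤ T) (hm : m + n = H) (ω : Fin n → Fin T) (k : Fin H) : Fin T :=
  if hk : m ≤ (k : ℕ) then ω ⟨(k : ℕ) - m, by omega⟩ else ⟨0, hT⟩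

theorem tailSeed_zero {H T : ℕ} (hT : 1 ≤ T) (hm : 0 + H = H) (ω : Fin H → Fin T) :
    tailSeed hT hm ω = ω := by
  funext k
  simp [tailSeed]

theorem tailSeed_cons_self {H T n : ℕ} (hT : 1 ≤ T) (h : Fin H) (hm : (h : ℕ) + (n + 1) = H)
    (j : Fin T) (ω : Fin n → Fin T) :
    tailSeed hT hm (Fin.cons j ω : Fin (n + 1) → Fin T) h = j := by
  simp only [tailSeed, le_refl, dif_pos, Nat.sub_self]
  rfl

theorem tailSeed_cons_of_lt {H T n m : ℕ} (hT : 1 ≤ T) (hm : m + (n + 1) = H)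
    (hm' : m + 1 + n = H) (j : Fin T) (ω : Fin n → Fin T) (k : Fin H) (hk : m + 1 ≤ (k : ℕ)) :
    tailSeed hT hm (Fin.cons j ω : Fin (n + 1) → Fin T) k = tailSeed hT hm' ω k := by
  unfold tailSeed
  rw [dif_pos (by omega), dif_pos hk]
  have e : (⟨(k : ℕ) - m, by omega⟩ : Fin (n + 1))
      = Fin.succ ⟨(k : ℕ) - (m + 1), by omega⟩ := Fin.ext (by simp; omega)
  rw [e, Fin.cons_succ]

theorem sum_chainProb_succ (H T n t : ℕ) (f : (Fin (n + 1) → Fin T) → ℝ) :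
    ∑ ω, chainProb H T (n + 1) t ω * f ω = ∑ j : Fin T, avgWeight H t ((j : ℕ) + 1) *
      ∑ ω : Fin n → Fin T, chainProb H T n ((j : ℕ) + 1) ω * f (Fin.cons j ω) := by
  rw [← (Fin.consEquiv fun _ : Fin (n + 1) => Fin T).sum_comp, Fintype.sum_prod_type]
  refine Finset.sum_congr rfl fun j _ => ?_
  rw [Finset.mul_sum]
  refine Finset.sum_congr rfl fun ω _ => ?_
  simp only [chainProb, Fin.consEquiv, Equiv.coe_fn_mk, Fin.cons_zero, Fin.tail_cons]
  ring

section ReplaceLaw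

variable {N : ℕ} {A : Fin N → Type*} [∀ i, Fintype (A i)] [∀ i, DecidableEq (A i)]

theorem sum_replaceLaw_mul (i : Fin N) (σ : stdSimplex ℝ (A i)) (x : ∀ j, stdSimplex ℝ (A j))
    (q : (∀ j, A j) → ℝ) :
    ∑ a, replaceLaw i σ (prodLaw x) a * q a = ∑ b, σ b * meanOthers q x i b := by
  have h1 : ∀ a : ∀ j, A j, replaceLaw i σ (prodLaw x) a
      = σ (a i) * ∏ j ∈ Finset.univ.erase i, x j (a j) := by
    intro a
    show σ (a i) * ∑ b : A i, prodLaw x (Function.update a i b) = _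
    congr 1
    have : ∀ b, prodLaw x (Function.update a i b)
        = x i b * ∏ j ∈ Finset.univ.erase i, x j (a j) := fun b => by
      rw [prodLaw_apply, ← Finset.mul_prod_erase _ _ (Finset.mem_univ i), Function.update_self]
      congr 1
      exact Finset.prod_congr rfl fun j hj => by
        rw [Function.update_of_ne (Finset.ne_of_mem_erase hj)]
    have h2 : ∑ b, x i b = 1 := (x i).2.2
    rw [Finset.sum_congr rfl fun b _ => this b, ← Finset.sum_mul, h2, one_mul]
  unfold meanOthers
  simp only [Finset.mul_sum]
  rw [Finset.sum_comm]
  refine Finset.sum_congr rfl fun a _ => ?_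
  simp only [mul_ite, mul_zero]
  rw [Finset.sum_ite_eq, if_pos (Finset.mem_univ _), h1, mul_assoc]

end ReplaceLaw

namespace MarkovGame

variable {N H : ℕ} {S : Type*} {A : Fin N → Type*} [Fintype S]

theorem totalReward_append (G : MarkovGame N H S A) (i : Fin N) (h : Fin H) {τ : History S A}
    (hτ : τ.length = h) (s : S) (a : ∀ j, A j) :
    G.totalReward i (τ ++ [(s, a)]) = G.totalReward i τ + G.reward i h s a := by
  unfold totalReward
  have e : G.reward i h s a = ∑ k : Fin H, if k = h then G.reward i h s a else 0 := by simp
  rw [e, ← Finset.sum_add_distrib]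
  refine Finset.sum_congr rfl fun k _ => ?_
  rcases lt_trichotomy (k : ℕ) (h : ℕ) with hk | hk | hk
  · rw [if_neg (by intro h'; rw [h'] at hk; omega), List.getElem?_append_left (by omega), add_zero]
  · obtain rfl : k = h := Fin.ext hk
    rw [if_pos rfl, List.getElem?_append_right hτ.le, List.getElem?_eq_none hτ.le, hτ]
    simp
  · rw [if_neg (by intro h'; rw [h'] at hk; omega), List.getElem?_eq_none (by simp; omega),
      List.getElem?_eq_none (by omega), add_zero]

variable [∀ i, Fintype (A i)]

theorem expect_last (G : MarkovGame N H S A)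
    (μ : Fin H → History S A → S → stdSimplex ℝ (∀ i, A i)) (τ : History S A) (s : S)
    (F : History S A → ℝ) : G.expect μ (Fin.last H) τ s F = F τ := by
  rw [expect, Fin.reverseInduction_last]

theorem expect_castSucc (G : MarkovGame N H S A)
    (μ : Fin H → History S A → S → stdSimplex ℝ (∀ i, A i)) (h : Fin H) (τ : History S A) (s : S)
    (F : History S A → ℝ) : G.expect μ h.castSucc τ s F
      = ∑ a, μ h τ s a * ∑ s', G.trans h s a s' * G.expect μ h.succ (τ ++ [(s, a)]) s' F := by
  rw [expect, Fin.reverseInduction_castSucc]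

/-- From step `j` on only later rules are read, so the placeholder entries of `tailSeed` before step
`m` play no role. -/
theorem expect_congr (G : MarkovGame N H S A)
    {μ μ' : Fin H → History S A → S → stdSimplex ℝ (∀ i, A i)} (j : Fin (H + 1))
    (hμ : ∀ k : Fin H, (j : ℕ) ≤ k → μ k = μ' k) : G.expect μ j = G.expect μ' j := by
  induction j using Fin.reverseInduction with
  | last => funext τ s F; rw [expect_last, expect_last]
  | cast h ih =>
    funext τ s F
    rw [expect_castSucc, expect_castSucc, hμ h le_rfl,
      ih fun k hk => hμ k (by simp at hk ⊢; omega)]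

/-- A one-step inequality for the weighted average over rounds propagates to the policy which
draws the round indices along the chain. -/
theorem chain_expect_le (G : MarkovGame N H S A) {T : ℕ} (hT : 1 ≤ T) (i : Fin N) (κ : ℝ)
    (μ : Fin T → Fin H → History S A → S → stdSimplex ℝ (∀ i, A i))
    (W : ℕ → Fin (H + 1) → S → ℝ) (hlast : ∀ t s, 0 ≤ W t (Fin.last H) s)
    (hstep : ∀ t, 1 ≤ t → t ≤ T → ∀ (h : Fin H) τ s,
      ∑ j : Fin T, avgWeight H t ((j : ℕ) + 1) * ∑ a, μ j h τ s a *
        (κ * G.reward i h s a + ∑ s', G.trans h s a s' * W ((j : ℕ) + 1) h.succ s')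
      ≤ W t h.castSucc s)
    (n : ℕ) (m : Fin (H + 1)) (hm : (m : ℕ) + n = H) {t : ℕ} (ht : 1 ≤ t) (htT : t ≤ T)
    {τ : History S A} (hτ : τ.length = m) (s : S) :
    κ * ∑ ω : Fin n → Fin T, chainProb H T n t ω *
        G.expect (fun k => μ (tailSeed hT hm ω k) k) m τ s (G.totalReward i)
      ≤ κ * G.totalReward i τ + W t m s := by
  induction n generalizing m t τ s with
  | zero =>
    obtain rfl : m = Fin.last H := Fin.ext (by simpa using hm)
    simp only [expect_last, chainProb, one_mul]
    simpa using hlast t s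
  | succ n ih =>
    obtain ⟨h, rfl⟩ : ∃ h : Fin H, m = h.castSucc :=
      ⟨⟨m, by omega⟩, rfl⟩
    have hm' : (h.succ : ℕ) + n = H := by
      simp only [Fin.val_succ, Fin.val_castSucc] at hm ⊢; omega
    have hex : ∀ (j : Fin T) (ω : Fin n → Fin T),
        G.expect (fun k => μ (tailSeed hT hm (Fin.cons j ω : Fin (n + 1) → Fin T) k) k)
          h.castSucc τ s (G.totalReward i)
        = ∑ a, μ j h τ s a * ∑ s', G.trans h s a s' *
          G.expect (fun k => μ (tailSeed hT hm' ω k) k) h.succ (τ ++ [(s, a)]) s'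
            (G.totalReward i) := by
      intro j ω
      have e1 := tailSeed_cons_self hT h hm j ω
      have e2 : G.expect (fun k => μ (tailSeed hT hm (Fin.cons j ω : Fin (n + 1) → Fin T) k) k)
          h.succ = G.expect (fun k => μ (tailSeed hT hm' ω k) k) h.succ :=
        G.expect_congr h.succ fun k hk => by
          rw [tailSeed_cons_of_lt hT hm hm' j ω k hk]
      rw [expect_castSucc, e2]
      simp only [e1]
    rw [sum_chainProb_succ]
    simp only [hex]
    have hswap : ∀ j : Fin T, κ * ∑ ω : Fin n → Fin T, chainProb H T n ((j : ℕ) + 1) ω *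
        ∑ a, μ j h τ s a * ∑ s', G.trans h s a s' *
          G.expect (fun k => μ (tailSeed hT hm' ω k) k) h.succ (τ ++ [(s, a)]) s'
            (G.totalReward i)
        = ∑ a, μ j h τ s a * ∑ s', G.trans h s a s' *
          (κ * ∑ ω : Fin n → Fin T, chainProb H T n ((j : ℕ) + 1) ω *
            G.expect (fun k => μ (tailSeed hT hm' ω k) k) h.succ (τ ++ [(s, a)]) s'
              (G.totalReward i)) := by
      intro j
      simp only [Finset.mul_sum]
      rw [Finset.sum_comm]
      refine Finset.sum_congr rfl fun a _ => ?_
      rw [Finset.sum_comm]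
      exact Finset.sum_congr rfl fun s' _ => Finset.sum_congr rfl fun ω _ => by ring
    have hle : ∀ j : Fin T, κ * ∑ ω : Fin n → Fin T, chainProb H T n ((j : ℕ) + 1) ω *
        ∑ a, μ j h τ s a * ∑ s', G.trans h s a s' *
          G.expect (fun k => μ (tailSeed hT hm' ω k) k) h.succ (τ ++ [(s, a)]) s'
            (G.totalReward i)
        ≤ κ * G.totalReward i τ + ∑ a, μ j h τ s a *
          (κ * G.reward i h s a + ∑ s', G.trans h s a s' * W ((j : ℕ) + 1) h.succ s') := by
      -- Given the round `j` at this step, the remaining indices form a chain started from the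
      -- weights of `j`, so the induction hypothesis applies with `t` replaced by `j`.
      intro j
      rw [hswap]
      have hμ1 : ∑ a, μ j h τ s a = 1 := (μ j h τ s).2.2
      have e : κ * G.totalReward i τ = ∑ a, μ j h τ s a * (κ * G.totalReward i τ) := by
        rw [← Finset.sum_mul, hμ1, one_mul]
      rw [e, ← Finset.sum_add_distrib]
      refine Finset.sum_le_sum fun a _ => ?_
      rw [← mul_add]
      refine mul_le_mul_of_nonneg_left ?_ ((μ j h τ s).2.1 a)
      have hP1 : ∑ s', G.trans h s a s' = 1 := (G.trans h s a).2.2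
      have e3 : κ * G.totalReward i τ + (κ * G.reward i h s a
          + ∑ s', G.trans h s a s' * W ((j : ℕ) + 1) h.succ s')
          = ∑ s', G.trans h s a s' * (κ * G.totalReward i (τ ++ [(s, a)])
            + W ((j : ℕ) + 1) h.succ s') := by
        rw [G.totalReward_append i h hτ]
        simp only [mul_add (G.trans h s a _), Finset.sum_add_distrib, ← Finset.sum_mul, hP1]
        ring
      rw [e3]
      refine Finset.sum_le_sum fun s' _ => mul_le_mul_of_nonneg_left ?_ ((G.trans h s a).2.1 s')
      exact ih h.succ hm' (by omega) (by omega) (by simpa using hτ) s'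
    have havg := sum_fin_avgWeight H T t ht htT
    rw [Finset.mul_sum]
    calc _ ≤ ∑ j : Fin T, avgWeight H t ((j : ℕ) + 1) * (κ * G.totalReward i τ + ∑ a, μ j h τ s a *
          (κ * G.reward i h s a + ∑ s', G.trans h s a s' * W ((j : ℕ) + 1) h.succ s')) := by
          refine Finset.sum_le_sum fun j _ => ?_
          rw [mul_left_comm]
          exact mul_le_mul_of_nonneg_left (hle j) (avgWeight_nonneg _ _ _)
      _ = κ * G.totalReward i τ + ∑ j : Fin T, avgWeight H t ((j : ℕ) + 1) * ∑ a, μ j h τ s a *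
          (κ * G.reward i h s a + ∑ s', G.trans h s a s' * W ((j : ℕ) + 1) h.succ s') := by
          simp only [mul_add (avgWeight _ _ _), Finset.sum_add_distrib, ← Finset.sum_mul, havg,
            one_mul]
      _ ≤ _ := add_le_add_right (hstep t ht htT h τ s) _

theorem vIter_eq_sum (G : MarkovGame N H S A) (π : PolicySeq H S A) {t : ℕ} (ht : 1 ≤ t)
    (i : Fin N) (h : Fin H) (s : S) :
    G.vIter π t i h.castSucc s = ∑ j ∈ Finset.range t, avgWeight H t (j + 1) *
      meanJoint (G.stagePayoff π (j + 1) i h s) (fun k => π (j + 1) k h s) := by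
  induction t, ht using Nat.le_induction with
  | base =>
    rw [show (1 : ℕ) = 0 + 1 from rfl, vIter_succ_castSucc, vIter_zero, Finset.sum_range_one,
      avgWeight_self H (0 + 1) le_rfl]
    ring
  | succ t ht ih =>
    rw [vIter_succ_castSucc, Finset.sum_range_succ, avgWeight_self H (t + 1) (by omega), ih,
      Finset.mul_sum]
    congr 1
    refine Finset.sum_congr rfl fun j hj => ?_
    rw [avgWeight_succ H t (j + 1) (by have := Finset.mem_range.mp hj; omega), mul_assoc]

/-- Unrolled over rounds, the `V`-update is precisely the evaluation of the chain of round indices.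
Taking `κ = -1` and `W = -V` turns the upper bound of `chain_expect_le` into the lower bound that is
needed. -/
theorem vIter_le_value_rollout (G : MarkovGame N H S A) {T : ℕ} (hT : 1 ≤ T)
    (π : PolicySeq H S A) (i : Fin N) : G.vIter π T i 0 G.init ≤ G.value (rollout T hT π) i := by
  have key := G.chain_expect_le hT i (-1) (fun j h _ s => prodLaw fun k => π ((j : ℕ) + 1) k h s)
    (fun t m s => -G.vIter π t i m s) (fun t s => by simp [vIter_last])
    (fun t ht htT h τ s => by
      have e : ∀ j : Fin T, (∑ a, prodLaw (fun k => π ((j : ℕ) + 1) k h s) a *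
          (-1 * G.reward i h s a + ∑ s', G.trans h s a s' * -G.vIter π ((j : ℕ) + 1) i h.succ s'))
          = -meanJoint (G.stagePayoff π ((j : ℕ) + 1) i h s) (fun k => π ((j : ℕ) + 1) k h s) := by
        intro j
        unfold meanJoint stagePayoff
        rw [← Finset.sum_neg_distrib]
        refine Finset.sum_congr rfl fun a _ => ?_
        simp only [mul_neg, Finset.sum_neg_distrib]
        ring
      simp only [e]
      simp only [mul_neg, Finset.sum_neg_distrib]
      rw [sum_fin_avgWeight_mul H T t htT (fun j => meanJoint (G.stagePayoff π j i h s)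
        (fun k => π j k h s)), ← G.vIter_eq_sum π ht])
    H 0 (by simp) hT le_rfl (τ := []) rfl G.init
  have e0 : G.totalReward i [] = 0 := by simp [totalReward]
  simp only [Fin.val_zero, tailSeed_zero, e0] at key
  have : G.value (rollout T hT π) i = ∑ ω : Fin H → Fin T, chainProb H T H T ω *
      G.expect (fun k _ s => prodLaw fun j => π ((ω k : ℕ) + 1) j k s) 0 [] G.init
        (G.totalReward i) := rfl
  rw [this]
  linarith

variable [∀ i, DecidableEq (A i)]

theorem value_deviate_le (G : MarkovGame N H S A) (hH : 1 ≤ H) {T : ℕ} (hT : 1 ≤ T)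
    (π : PolicySeq H S A) (i : Fin N) {C : ℝ} (hC : 0 ≤ C)
    (hreg : ∀ (h : Fin H) s t, 1 ≤ t → t ≤ T → ∀ b,
      ∑ j ∈ Finset.range t, avgWeight H t (j + 1) * G.gain π i h s (j + 1) b ≤ C / t)
    (σ : Deviation H S A i) :
    G.value ((rollout T hT π).deviate i σ) i ≤ G.vIter π T i 0 G.init + 3 * H * C / T := by
  set r : ℝ := 1 + 1 / (H : ℝ) with hr
  have hr1 : 1 ≤ r := by
    have : (0 : ℝ) ≤ 1 / H := by positivity
    linarith
  have key := G.chain_expect_le hT i 1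
    (fun j h τ s => replaceLaw i (σ h τ s) (prodLaw fun k => π ((j : ℕ) + 1) k h s))
    -- With `n` steps left the excess over `V^(t)` is at most `n r^n C / t`: the current step adds
    -- `C / t` of regret, and averaging the later excess over the next index multiplies it by `r = 1
    -- + 1/H`.
    (fun t m s => G.vIter π t i m s + ((H - m : ℕ) : ℝ) * r ^ (H - m : ℕ) * C / t)
    (fun t s => by simp [vIter_last])
    (fun t ht htT h τ s => by
      have ht0 : (0 : ℝ) < t := by exact_mod_cast ht
      obtain ⟨n, hn⟩ : ∃ n, H - (h : ℕ) = n + 1 := ⟨H - h - 1, by omega⟩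
      have hn' : H - ((h : ℕ) + 1) = n := by omega
      simp only [Fin.val_succ, Fin.val_castSucc, hn, hn', one_mul]
      have hσ1 : ∑ b, σ h τ s b = 1 := (σ h τ s).2.2
      have e : ∀ j : Fin T, (∑ a, replaceLaw i (σ h τ s)
          (prodLaw fun k => π ((j : ℕ) + 1) k h s) a *
          (G.reward i h s a + ∑ s', G.trans h s a s' * (G.vIter π ((j : ℕ) + 1) i h.succ s'
            + (n : ℝ) * r ^ n * C / ((j : ℕ) + 1 : ℕ))))
          = ∑ b, σ h τ s b * G.gain π i h s ((j : ℕ) + 1) b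
            + meanJoint (G.stagePayoff π ((j : ℕ) + 1) i h s) (fun k => π ((j : ℕ) + 1) k h s)
            + (n : ℝ) * r ^ n * C / ((j : ℕ) + 1 : ℕ) := by
        intro j
        have h1 : ∀ a, G.reward i h s a + ∑ s', G.trans h s a s' *
            (G.vIter π ((j : ℕ) + 1) i h.succ s' + (n : ℝ) * r ^ n * C / ((j : ℕ) + 1 : ℕ))
            = G.stagePayoff π ((j : ℕ) + 1) i h s a + (n : ℝ) * r ^ n * C / ((j : ℕ) + 1 : ℕ) := by
          intro a
          have hP1 : ∑ s', G.trans h s a s' = 1 := (G.trans h s a).2.2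
          simp only [mul_add, Finset.sum_add_distrib, ← Finset.sum_mul, hP1, stagePayoff]
          ring
        have h2 : ∑ a, replaceLaw i (σ h τ s) (prodLaw fun k => π ((j : ℕ) + 1) k h s) a = 1 :=
          (replaceLaw i (σ h τ s) _).2.2
        simp only [h1]
        simp only [mul_add, Finset.sum_add_distrib, ← Finset.sum_mul, h2]
        rw [sum_replaceLaw_mul, one_mul]
        congr 1
        unfold gain
        simp only [Nat.succ_ne_zero, if_false, mul_sub, Finset.sum_sub_distrib, ← Finset.sum_mul,
          hσ1]
        ring
      simp only [e]
      simp only [mul_add (avgWeight _ _ _), Finset.sum_add_distrib]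
      have s1 : ∑ j : Fin T, avgWeight H t ((j : ℕ) + 1) *
          ∑ b, σ h τ s b * G.gain π i h s ((j : ℕ) + 1) b ≤ C / t := by
        -- The deviation does not see the round index, so its law factors out of the average over
        -- rounds. What remains for each action is an averaged regret against a fixed action.
        have e1 : ∑ j : Fin T, avgWeight H t ((j : ℕ) + 1) *
            ∑ b, σ h τ s b * G.gain π i h s ((j : ℕ) + 1) b
            = ∑ b, σ h τ s b * ∑ j ∈ Finset.range t,
              avgWeight H t (j + 1) * G.gain π i h s (j + 1) b := by
          rw [sum_fin_avgWeight_mul H T t htT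
            (fun j => ∑ b, σ h τ s b * G.gain π i h s j b)]
          simp only [Finset.mul_sum]
          rw [Finset.sum_comm]
          exact Finset.sum_congr rfl fun b _ => Finset.sum_congr rfl fun j _ => by ring
        rw [e1]
        calc _ ≤ ∑ b, σ h τ s b * (C / t) := Finset.sum_le_sum fun b _ =>
              mul_le_mul_of_nonneg_left (hreg h s t ht htT b) ((σ h τ s).2.1 b)
          _ = C / t := by rw [← Finset.sum_mul, hσ1, one_mul]
      have s2 : ∑ j : Fin T, avgWeight H t ((j : ℕ) + 1) *
          ((n : ℝ) * r ^ n * C / ((j : ℕ) + 1 : ℕ)) ≤ n * r ^ (n + 1) * C / t := by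
        rw [sum_fin_avgWeight_mul H T t htT (fun j => (n : ℝ) * r ^ n * C / (j : ℕ))]
        have h1 := mul_le_mul_of_nonneg_left (sum_avgWeight_div_le H t hH ht)
          (show 0 ≤ (n : ℝ) * r ^ n * C by positivity)
        rw [Finset.mul_sum] at h1
        calc _ = ∑ j ∈ Finset.range t, (n : ℝ) * r ^ n * C *
              (avgWeight H t (j + 1) / ((j : ℝ) + 1)) := by
              refine Finset.sum_congr rfl fun j _ => ?_
              push_cast
              ring
          _ ≤ _ := h1
          _ = _ := by rw [← hr]; ring
      rw [sum_fin_avgWeight_mul H T t htT (fun j => meanJoint (G.stagePayoff π j i h s)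
        (fun k => π j k h s)), ← G.vIter_eq_sum π ht]
      have s3 : C / t + n * r ^ (n + 1) * C / t ≤ ((n + 1 : ℕ) : ℝ) * r ^ (n + 1) * C / t := by
        rw [← add_div]
        refine div_le_div_of_nonneg_right ?_ ht0.le
        have := mul_le_mul_of_nonneg_right (one_le_pow₀ hr1 (n := n + 1)) hC
        push_cast
        linarith
      linarith)
    H 0 (by simp) hT le_rfl (τ := []) rfl G.init
  have e0 : G.totalReward i [] = 0 := by simp [totalReward]
  simp only [Fin.val_zero, tailSeed_zero, e0, Nat.sub_zero, one_mul, zero_add] at key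
  have : G.value ((rollout T hT π).deviate i σ) i = ∑ ω : Fin H → Fin T, chainProb H T H T ω *
      G.expect (fun k τ s => replaceLaw i (σ k τ s)
        (prodLaw fun j => π ((ω k : ℕ) + 1) j k s)) 0 [] G.init (G.totalReward i) := rfl
  rw [this]
  refine key.trans (add_le_add_right ?_ _)
  have hT0 : (0 : ℝ) < T := by exact_mod_cast hT
  refine div_le_div_of_nonneg_right (mul_le_mul_of_nonneg_right ?_ hC) hT0.le
  rw [mul_comm]
  exact mul_le_mul_of_nonneg_right (one_add_inv_pow_le_three hH) (Nat.cast_nonneg H)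

theorem cceGap_rollout_le [∀ i, Nonempty (A i)] (G : MarkovGame N H S A) (hN : 1 ≤ N) (hH : 1 ≤ H)
    {T : ℕ} (hT : 1 ≤ T) (π : PolicySeq H S A) {C : ℝ} (hC : 0 ≤ C)
    (hreg : ∀ (i : Fin N) (h : Fin H) s t, 1 ≤ t → t ≤ T → ∀ b,
      ∑ j ∈ Finset.range t, avgWeight H t (j + 1) * G.gain π i h s (j + 1) b ≤ C / t) :
    G.cceGap (rollout T hT π) ≤ 3 * H * C / T := by
  have : Nonempty (Fin N) := ⟨⟨0, hN⟩⟩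
  refine ciSup_le fun i => ?_
  have : Nonempty (Deviation H S A i) := ⟨fun _ _ _ => pureLaw (Classical.arbitrary (A i))⟩
  have h1 : G.bestResponseValue (rollout T hT π) i ≤ G.vIter π T i 0 G.init + 3 * H * C / T :=
    ciSup_le fun σ => G.value_deviate_le hH hT π i hC (hreg i) σ
  linarith [G.vIter_le_value_rollout hT π i]

end MarkovGame

/-! ### The main theorem -/

theorem theorem1 {N H T : ℕ} (hN : 1 ≤ N) (hH : 1 ≤ H) (hT : 1 ≤ T)
    {S : Type*} [Fintype S] {A : Fin N → Type*} [∀ i, Fintype (A i)] [∀ i, DecidableEq (A i)]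
    [∀ i, Nonempty (A i)] (G : MarkovGame N H S A)
    (β αt η : ℝ) (hβ : 70 ≤ β)
    (hαt : αt = β * Real.log (maxActions A) ^ 2 + 2 * Real.log (maxActions A) + 2)
    (hη : η = 1 / (24 * (H : ℝ) ^ (3 / 2 : ℝ) * N)) :
    (∃ π : PolicySeq H S A, G.IsOFTRLRun T αt η π) ∧
    ∀ π : PolicySeq H S A,
      (G.IsOFTRLRun T αt η π ↔ G.IsOMWURun T αt η π) ∧
      (G.IsOFTRLRun T αt η π →
        G.cceGap (rollout T hT π) ≤
          864 * (H : ℝ) ^ (7 / 2 : ℝ) * N *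
            (αt * Real.log T + 2 * Real.log (maxActions A) + 2) / T) := by
  have hcard : 1 ≤ maxActions A :=
    Fintype.card_pos.trans_le (card_le_maxActions A ⟨0, hN⟩)
  have hL0 : 0 ≤ Real.log (maxActions A) := Real.log_nonneg (by exact_mod_cast hcard)
  have hα1 : 1 < αt := by
    rw [hαt]
    have : 0 ≤ β * Real.log (maxActions A) ^ 2 := by positivity
    linarith
  have hH' : (1 : ℝ) ≤ H := by exact_mod_cast hH
  have hN' : (1 : ℝ) ≤ N := by exact_mod_cast hN
  have hT' : (1 : ℝ) ≤ T := by exact_mod_cast hT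
  have hH0 : (0 : ℝ) < H := by linarith
  set p : ℝ := (H : ℝ) ^ (3 / 2 : ℝ) with hp
  have hp0 : 0 < p := Real.rpow_pos_of_pos hH0 _
  have hp2 : p ^ 2 = (H : ℝ) ^ 3 := by
    rw [hp, ← Real.rpow_natCast, ← Real.rpow_mul hH0.le, ← Real.rpow_natCast]
    norm_num
  have hp7 : (H : ℝ) ^ (7 / 2 : ℝ) = p * (H : ℝ) ^ 2 := by
    rw [hp, ← Real.rpow_natCast, ← Real.rpow_add hH0]
    norm_num
  have hHp : (H : ℝ) ≤ p := by
    have := Real.rpow_le_rpow_of_exponent_le hH' (show (1 : ℝ) ≤ 3 / 2 by norm_num)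
    rwa [Real.rpow_one] at this
  have hη0 : 0 < η := by rw [hη]; positivity
  have hηN : η ^ 2 * H ^ 3 * N ^ 2 = 1 / 576 := by
    rw [hη, ← hp2]
    field_simp
    norm_num
  have hηH : η * H ≤ 1 / 24 := by
    rw [hη, div_mul_eq_mul_div, one_mul, div_le_div_iff₀ (by positivity) (by norm_num)]
    nlinarith
  refine ⟨?_, fun π => ⟨G.isOFTRLRun_iff_isOMWURun T αt η π, fun hπ => ?_⟩⟩
  · obtain ⟨π, hπ⟩ := G.exists_isOMWURun T hα1 η
    exact ⟨π, (G.isOFTRLRun_iff_isOMWURun T αt η π).mpr hπ⟩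
  · have hπ' := (G.isOFTRLRun_iff_isOMWURun T αt η π).mp hπ
    set D := αt * Real.log T + 2 * Real.log (maxActions A) + 2 with hD
    have hD0 : 0 ≤ D := by
      have := mul_nonneg (by linarith : 0 ≤ αt) (Real.log_nonneg hT')
      linarith
    have hgap := G.cceGap_rollout_le hN hH hT π (C := 2 * H / η * D) (by positivity)
      (fun i h s t ht htT b => G.sum_avgWeight_mul_gain_le hH hβ hαt hη0 hηN hηH hπ' h s ht htT i b)
    refine hgap.trans (div_le_div_of_nonneg_right ?_ (by linarith))
    -- Here `1/η = 24 p N`, so the argument gives the constant `6 · 24 = 144`, a factor `6` below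
    -- the claimed `864`.
    have e : 3 * H * (2 * H / η * D) = 144 * (p * (H : ℝ) ^ 2) * N * D := by
      rw [hη]
      field_simp
      ring
    rw [e, hp7]
    have : 0 ≤ p * (H : ℝ) ^ 2 * N * D := by positivity
    linarith
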